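/- Let $n\in\mathbb N$, let $\mathbb B^n=\{z\in\mathbb C^n:\|z\|<1\}$ be the open Euclidean unit ball, and let $\langle\cdot,\cdot\rangle$ be the Euclidean Hermitian inner product. A normalized Loewner chain on $\mathbb B^n$ is a family $(f_t)_{t\ge 0}$ of univalent (that is, holomorphic and injective) mappings $f_t:\mathbb B^n\to\mathbb C^n$ such that $f_t(0)=0$ and $d(f_t)_0=e^t\,\mathrm{id}$ for all $t\ge 0$, and such that for all $0\le s\le t$ there is a holomorphic mapping $\varphi_{s,t}:\mathbb B^n\to\mathbb B^n$ with $\varphi_{s,t}(0)=0$ and $f_s=f_t\circ\varphi_{s,t}$. **Proposition.** Let $(f_t)_{t\ge0}$ be a normalized Loewner chain on $\mathbb B^n$, let $0\le T_1<T_2\le\infty$ with $T_1<\infty$, and let $a\in(0,1]$. The following conditions are equivalent: 1. For a.e. $t\in[T_1,T_2)$ and for all $z\in\mathbb B^n\setminus\{0\}$, the derivative $\frac{\partial f_t}{\partial t}(z)$ exists, $d(f_t)_z$ is invertible, and $$\Re\left\langle [d(f_t)_z]^{-1}\frac{\partial f_t}{\partial t}(z),\frac{z}{\|z\|^2}\right\rangle\ge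 a.$$ 2. For all $T_1\le s<t<T_2$ and all $z\in\mathbb B^n$, $$\|f_t^{-1}(f_s(z))\|\le e^{a(s-t)}\|z\|,$$ where $f_t^{-1}:f_t(\mathbb B^n)\to\mathbb B^n$ is the inverse of $f_t$. Moreover, if one of these conditions (and hence both) is satisfied, then $f_t(\mathbb B^n)$ is bounded for all $t\in[0,T_2)$, and $\overline{f_s(\mathbb B^n)}\subset f_t(\mathbb B^n)$ for all $T_1\le s<t<T_2$. -/

import Mathlib

open MeasureTheory Set

namespace LoewnerBall

/-- The space `ℂⁿ` with its Euclidean norm and Hermitian inner product. -/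
abbrev Cn (n : ℕ) : Type := EuclideanSpace ℂ (Fin n)

/-- The open Euclidean unit ball `𝔹ⁿ` of `ℂⁿ`. -/
abbrev unitBall (n : ℕ) : Set (Cn n) := Metric.ball (0 : Cn n) 1

/-- `(f t)`, `t ≥ 0`, is a normalized subordination chain on the unit ball: each `f t` is
holomorphic on the ball, `f t 0 = 0`, `d(f t)_0 = e^t id`, and for `0 ≤ s ≤ t` there is a
holomorphic self-map `φ` of the ball with `φ 0 = 0` and `f s = f t ∘ φ` on the ball.
Values for `t < 0`, or outside the ball, are irrelevant. -/
structure IsNormalizedSubordinationChain {n : ℕ} (f : ℝ → Cn n → Cn n) : Prop where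
  holomorphic : ∀ t : ℝ, 0 ≤ t → DifferentiableOn ℂ (f t) (unitBall n)
  map_zero : ∀ t : ℝ, 0 ≤ t → f t 0 = 0
  fderiv_zero : ∀ t : ℝ, 0 ≤ t →
    fderiv ℂ (f t) 0 = ((Real.exp t : ℝ) : ℂ) • ContinuousLinearMap.id ℂ (Cn n)
  subordinate : ∀ s t : ℝ, 0 ≤ s → s ≤ t →
    ∃ φ : Cn n → Cn n, DifferentiableOn ℂ φ (unitBall n) ∧
      MapsTo φ (unitBall n) (unitBall n) ∧ φ 0 = 0 ∧
      EqOn (f s) (f t ∘ φ) (unitBall n)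

/-- A normalized Loewner chain on the unit ball: a normalized subordination chain all of whose
members are univalent, that is, holomorphic and injective on the ball. -/
structure IsNormalizedLoewnerChain {n : ℕ} (f : ℝ → Cn n → Cn n) : Prop
    extends IsNormalizedSubordinationChain f where
  injOn : ∀ t : ℝ, 0 ≤ t → InjOn (f t) (unitBall n)

/-- The vector `[d(f t)_z]⁻¹ (∂f_t/∂t (z))`. It is `0` when `d(f t)_z` is not invertible or
`τ ↦ f τ z` is not differentiable at `t`. -/
noncomputable def loewnerField {n : ℕ} (f : ℝ → Cn n → Cn n) (t : ℝ) (z : Cn n) : Cn n :=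
  (fderiv ℂ (f t) z).inverse (deriv (fun τ : ℝ => f τ z) t)

/-- The infinitesimal squeezing condition: for a.e. `t ∈ [T₁, T₂)` and every `z ≠ 0` in the ball,
`Re ⟨[d(f t)_z]⁻¹ (∂f_t/∂t (z)), z/‖z‖²⟩ ≥ a`.
For `a > 0` it contains the existence of `∂f_t/∂t (z)` and the invertibility of `d(f t)_z`, see
`differentiableAt_and_isInvertible_of_le` below. -/
def InfinitesimalSqueezing {n : ℕ} (f : ℝ → Cn n → Cn n) (T₁ : ℝ) (T₂ : EReal) (a : ℝ) : Prop :=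
  ∀ᵐ t : ℝ ∂volume, T₁ ≤ t → (t : EReal) < T₂ →
    ∀ z ∈ unitBall n, z ≠ 0 →
      a ≤ (inner ℂ ((1 / ‖z‖ ^ 2 : ℝ) • z) (loewnerField f t z)).re

/-- The integrated squeezing condition: `‖f_t⁻¹ (f_s z)‖ ≤ e^{a(s-t)} ‖z‖` for all
`T₁ ≤ s < t < T₂` and all `z` in the ball, where `f_t⁻¹` is the inverse of the restriction of `f t`
to the ball (for a Loewner chain, `f s z` lies in its domain). -/
def IntegratedSqueezing {n : ℕ} (f : ℝ → Cn n → Cn n) (T₁ : ℝ) (T₂ : EReal) (a : ℝ) : Prop :=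
  ∀ s t : ℝ, T₁ ≤ s → s < t → (t : EReal) < T₂ →
    ∀ z ∈ unitBall n,
      ‖Function.invFunOn (f t) (unitBall n) (f s z)‖ ≤ Real.exp (a * (s - t)) * ‖z‖

/-- The inequality in the infinitesimal squeezing condition can only hold where the time
derivative exists and the space derivative is invertible. -/
theorem differentiableAt_and_isInvertible_of_le {n : ℕ} {f : ℝ → Cn n → Cn n} {a t : ℝ} {z : Cn n}
    (ha : 0 < a) (h : a ≤ (inner ℂ ((1 / ‖z‖ ^ 2 : ℝ) • z) (loewnerField f t z)).re) :
    DifferentiableAt ℝ (fun τ : ℝ => f τ z) t ∧ (fderiv ℂ (f t) z).IsInvertible := by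
  constructor
  · by_contra hd
    rw [loewnerField, deriv_zero_of_not_differentiableAt hd] at h
    simp only [_root_.map_zero, inner_zero_right, Complex.zero_re] at h
    linarith
  · by_contra hd
    rw [loewnerField, ContinuousLinearMap.inverse_of_not_isInvertible hd] at h
    simp only [_root_.zero_apply, inner_zero_right, Complex.zero_re] at h
    linarith

end LoewnerBall

/-!
The proof rests on Loewner's equation for the transition maps `φ_{s,t} = f_t⁻¹ ∘ f_s`. If
`τ ↦ f_τ z` is differentiable at `t`, then expanding `f_τ (φ_{t,τ} z) = f_t z` to first order in
`τ - t` shows that `τ ↦ φ_{t,τ} z` has right derivative `-[d(f_t)_z]⁻¹ (∂f_t/∂t (z))` at `τ = t`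
(`hasDerivWithinAt_transition`). Comparing `Re ⟨z, φ_{t,τ} z⟩` with `e^{a(t-τ)} ‖z‖²` to the right
of `τ = t`, where they agree, turns the integrated condition into the infinitesimal one. Conversely,
since `φ_{s,σ} = φ_{τ,σ} ∘ φ_{s,τ}`, the infinitesimal condition makes the derivative of the
absolutely continuous function `τ ↦ e^{2aτ} ‖φ_{s,τ} z‖²` nonpositive almost everywhere. The
remaining claims hold because the integrated condition puts `f_s (𝔹ⁿ)` inside the image under `f_t`
of a closed ball of radius less than one, which is compact.

Three facts are needed to make sense of this.

* *Invertibility of `d(f_t)_z`*: Osgood's theorem (`fderiv_injective_of_injOn`) that an injective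
  holomorphic map between spaces of the same finite dimension has invertible derivatives. By
  induction on the dimension the derivative at each point is zero or invertible. If it vanishes
  somewhere and the dimension is at least two, the zero set of the Jacobian determinant contains a
  holomorphic curve (`exists_graph_subset_zeros`), and the map is constant along it. In dimension
  one the inverse function extends holomorphically over the isolated critical values.
* *Lipschitz continuity in time*: a self-map `φ` of the ball with `φ 0 = 0` and `dφ₀ = λ id`
  satisfies `‖z - φ z‖ ≤ C (1 - λ)` on smaller balls (`norm_sub_le_of_mapsTo_unitBall`). Harnack's
  inequality on complex lines through `0` controls `⟨z, z - φ z⟩`, and the maximum principle on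
  small circles about a point recovers the whole vector from it.
* *Differentiability in time for a.e. `t` and all `z` at once* (`ae_forall_differentiableAt`):
  Lipschitz functions of time are differentiable a.e., so this holds on a countable dense set of
  `z`, and the difference quotients are equi-Lipschitz in `z` by the Cauchy estimate.
-/

open Filter Topology Metric

/-! ### Holomorphic maps between normed spaces -/

section SeveralVariables

variable {E F : Type*} [NormedAddCommGroup E] [NormedSpace ℂ E] [NormedAddCommGroup F]
  [NormedSpace ℂ F]

/-- **Cauchy estimate**, with a non-optimal constant. -/
theorem norm_fderiv_le_of_norm_le_ball {f : E → F} {c : E} {R M : ℝ} (hR : 0 < R)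
    (hf : DifferentiableOn ℂ f (ball c R)) (hM : ∀ z ∈ ball c R, ‖f z‖ ≤ M) :
    ‖fderiv ℂ f c‖ ≤ 2 * M / R := by
  refine Complex.norm_fderiv_le_div_of_mapsTo_ball hf (fun z hz => ?_) hR
  rw [mem_closedBall, dist_eq_norm]
  calc ‖f z - f c‖ ≤ ‖f z‖ + ‖f c‖ := norm_sub_le _ _
    _ ≤ 2 * M := by linarith [hM z hz, hM c (mem_ball_self hR)]

theorem norm_image_sub_le_of_norm_le_ball {f : E → F} {c : E} {r R M : ℝ} (hrR : r < R)
    (hf : DifferentiableOn ℂ f (ball c R)) (hM : ∀ z ∈ ball c R, ‖f z‖ ≤ M) {x y : E}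
    (hx : x ∈ closedBall c r) (hy : y ∈ closedBall c r) :
    ‖f y - f x‖ ≤ 2 * M / (R - r) * ‖y - x‖ := by
  have hsub : ∀ z ∈ closedBall c r, ball z (R - r) ⊆ ball c R := fun z hz w hw => by
    rw [mem_ball] at *; rw [mem_closedBall] at hz
    linarith [dist_triangle w z c]
  let _ : NormedSpace ℝ E := NormedSpace.restrictScalars ℝ ℂ E
  refine Convex.norm_image_sub_le_of_norm_fderiv_le (𝕜 := ℂ) (s := closedBall c r)
    (fun z hz => ?_) (fun z hz => ?_) (convex_closedBall c r) hx hy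
  · exact hf.differentiableAt (isOpen_ball.mem_nhds (closedBall_subset_ball hrR hz))
  · exact norm_fderiv_le_of_norm_le_ball (sub_pos.2 hrR) (hf.mono (hsub z hz))
      fun w hw => hM w (hsub z hz hw)

/-- Taylor's formula of order one with a quadratic remainder: the remainder vanishes to second
order, so Schwarz's lemma bounds it. -/
theorem norm_sub_sub_fderiv_le_of_norm_le_ball {f : E → F} {c : E} {R M : ℝ} (hR : 0 < R)
    (hf : DifferentiableOn ℂ f (ball c R)) (hM : ∀ z ∈ ball c R, ‖f z‖ ≤ M) {z : E}
    (hz : z ∈ ball c R) :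
    ‖f z - f c - fderiv ℂ f c (z - c)‖ ≤ 4 * M * (‖z - c‖ / R) ^ 2 := by
  set g : E → F := fun w => f w - f c - fderiv ℂ f c (w - c) with hg
  have hgc : g c = 0 := by simp [hg]
  have hfc : HasFDerivAt f (fderiv ℂ f c) c :=
    (hf.differentiableAt (ball_mem_nhds c hR)).hasFDerivAt
  have hB := norm_fderiv_le_of_norm_le_ball hR hf hM
  have hM0 : 0 ≤ M := (norm_nonneg _).trans (hM c (mem_ball_self hR))
  have key := Complex.dist_le_mul_div_pow_of_mapsTo_ball_of_isLittleO (f := g) (c := c) (z := z)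
    (R₁ := R) (R₂ := 4 * M) (n := 1) ?_ ?_ ?_ hz
  · rwa [hgc, dist_zero_right, dist_eq_norm] at key
  · exact (hf.sub_const _).sub (by fun_prop)
  · intro w hw
    rw [hgc, mem_closedBall, dist_zero_right]
    have h1 : ‖fderiv ℂ f c (w - c)‖ ≤ 2 * M / R * R := by
      refine (ContinuousLinearMap.le_opNorm _ _).trans ?_
      gcongr
      rw [mem_ball, dist_eq_norm] at hw; exact hw.le
    rw [div_mul_cancel₀ _ hR.ne'] at h1
    calc ‖g w‖ ≤ ‖f w - f c‖ + ‖fderiv ℂ f c (w - c)‖ := norm_sub_le _ _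
      _ ≤ ‖f w‖ + ‖f c‖ + ‖fderiv ℂ f c (w - c)‖ := by gcongr; exact norm_sub_le _ _
      _ ≤ 4 * M := by linarith [hM w hw, hM c (mem_ball_self hR)]
  · have := hfc.isLittleO
    simp only [hgc, sub_zero, pow_one]
    exact this.norm_right

theorem hasFDerivAt_of_norm_sub_sub_le_sq {f : E → F} {A : E →L[ℂ] F} {p : E} {C : ℝ}
    (h : ∀ᶠ z in 𝓝 p, ‖f z - f p - A (z - p)‖ ≤ C * ‖z - p‖ ^ 2) : HasFDerivAt f A p := by
  refine HasFDerivAt.of_isLittleO ?_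
  refine (Asymptotics.IsBigO.of_bound C (g := fun z => ‖z - p‖ ^ 2) ?_).trans_isLittleO
    (Asymptotics.isLittleO_pow_sub_sub p one_lt_two)
  filter_upwards [h] with z hz
  simpa using hz

/-- **Weierstrass convergence theorem** at the centre of a ball, for maps between Banach spaces. -/
theorem differentiableAt_of_tendstoUniformlyOn_ball [CompleteSpace F] {ι : Type*} {l : Filter ι}
    [l.NeBot] {u : ι → E → F} {f : E → F} {p : E} {R M : ℝ} (hR : 0 < R)
    (hu : ∀ᶠ i in l, DifferentiableOn ℂ (u i) (ball p R) ∧ ∀ z ∈ ball p R, ‖u i z‖ ≤ M)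
    (h : TendstoUniformlyOn u f l (ball p R)) : DifferentiableAt ℂ f p := by
  -- By the Cauchy estimate the derivatives at `p` form a Cauchy net.
  have hc : Cauchy (map (fun i => fderiv ℂ (u i) p) l) := by
    rw [cauchy_map_iff]
    refine ⟨‹_›, Metric.uniformity_basis_dist.tendsto_right_iff.2 fun ε hε => ?_⟩
    have h1 := h.uniformCauchySeqOn _
      (Metric.dist_mem_uniformity (show 0 < ε * R / 4 by positivity))
    have h2 := (hu.prod_mk hu)
    filter_upwards [h1, h2] with ij hij hd
    have h3 := norm_fderiv_le_of_norm_le_ball (f := u ij.1 - u ij.2) (M := ε * R / 4) hR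
      (hd.1.1.sub hd.2.1) (fun z hz => by
        have := hij z hz
        simp only [dist_eq_norm] at this
        exact this.le)
    rw [fderiv_sub (hd.1.1.differentiableAt (ball_mem_nhds p hR))
      (hd.2.1.differentiableAt (ball_mem_nhds p hR)), ← dist_eq_norm] at h3
    have : 2 * (ε * R / 4) / R = ε / 2 := by field_simp; norm_num
    show dist _ _ < ε
    linarith
  obtain ⟨A, hA⟩ := cauchy_map_iff_exists_tendsto.1 hc
  refine (hasFDerivAt_of_norm_sub_sub_le_sq (A := A) (C := 4 * M / R ^ 2) ?_).differentiableAt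
  filter_upwards [ball_mem_nhds p hR] with z hz
  have ht : Tendsto (fun i => ‖u i z - u i p - fderiv ℂ (u i) p (z - p)‖) l
      (𝓝 ‖f z - f p - A (z - p)‖) :=
    (((h.tendsto_at hz).sub (h.tendsto_at (mem_ball_self hR))).sub
      (((ContinuousLinearMap.apply ℂ F (z - p)).continuous.tendsto A).comp hA)).norm
  refine le_of_tendsto ht ?_
  filter_upwards [hu] with i hi
  refine (norm_sub_sub_fderiv_le_of_norm_le_ball hR hi.1 hi.2 hz).trans_eq ?_
  field_simp

/-- The derivative of a holomorphic map in a fixed direction is holomorphic. -/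
theorem DifferentiableOn.fderiv_apply_const [CompleteSpace F] {f : E → F} {U : Set E}
    (hU : IsOpen U) (hf : DifferentiableOn ℂ f U) (v : E) :
    DifferentiableOn ℂ (fun z => fderiv ℂ f z v) U := by
  intro p hp
  refine DifferentiableAt.differentiableWithinAt ?_
  have hfp := (hf.differentiableAt (hU.mem_nhds hp)).continuousAt
  have hb : ∀ᶠ z in 𝓝 p, z ∈ U ∧ ‖f z‖ ≤ ‖f p‖ + 1 :=
    Filter.Eventually.and (hU.mem_nhds hp)
      ((hfp.norm.eventually (gt_mem_nhds (lt_add_one _))).mono fun z hz => hz.le)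
  obtain ⟨R, hR, hball⟩ := Metric.eventually_nhds_iff_ball.1 hb
  set M := ‖f p‖ + 1 with hM
  have hM0 : 0 ≤ M := by positivity
  obtain ⟨r, hr, rfl⟩ : ∃ r, 0 < r ∧ R = 2 * r := ⟨R / 2, by positivity, by ring⟩
  have hsub : ∀ z ∈ ball p r, ball z r ⊆ ball p (2 * r) := fun z hz w hw => by
    rw [mem_ball] at *; linarith [dist_triangle w z p]
  have hd : DifferentiableOn ℂ f (ball p (2 * r)) := hf.mono fun z hz => (hball z hz).1
  -- The difference quotients converge uniformly near `p`.
  have hest : ∀ᶠ h : ℂ in 𝓝[≠] 0, ∀ z ∈ ball p r, z + h • v ∈ ball z r ∧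
      ‖h⁻¹ • (f (z + h • v) - f z) - fderiv ℂ f z v‖ ≤ 4 * M * ‖v‖ ^ 2 / r ^ 2 * ‖h‖ := by
    have h0 : ∀ᶠ h : ℂ in 𝓝[≠] 0, ‖h • v‖ < r := by
      have : Tendsto (fun h : ℂ => ‖h • v‖) (𝓝 0) (𝓝 ‖(0 : ℂ) • v‖) :=
        Continuous.tendsto (by fun_prop) 0
      exact nhdsWithin_le_nhds (this.eventually (gt_mem_nhds (by simpa using hr)))
    filter_upwards [h0, self_mem_nhdsWithin] with h hh hne z hz
    have hmem : z + h • v ∈ ball z r := by simpa [mem_ball, dist_eq_norm] using hh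
    refine ⟨hmem, ?_⟩
    have hne : h ≠ 0 := hne
    have := norm_sub_sub_fderiv_le_of_norm_le_ball hr (hd.mono (hsub z hz))
      (fun w hw => (hball w (hsub z hz hw)).2) hmem
    rw [add_sub_cancel_left, map_smul, norm_smul] at this
    have e : h⁻¹ • (f (z + h • v) - f z) - fderiv ℂ f z v
        = h⁻¹ • (f (z + h • v) - f z - h • fderiv ℂ f z v) := by
      rw [smul_sub h⁻¹ (_ - _), inv_smul_smul₀ hne]
    rw [e, norm_smul, norm_inv]
    have hn : 0 < ‖h‖ := norm_pos_iff.2 hne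
    calc ‖h‖⁻¹ * _ ≤ ‖h‖⁻¹ * (4 * M * (‖h‖ * ‖v‖ / r) ^ 2) := by gcongr
      _ = _ := by field_simp
  have hsmall : ∀ ε > 0, ∀ᶠ h : ℂ in 𝓝[≠] 0, 4 * M * ‖v‖ ^ 2 / r ^ 2 * ‖h‖ < ε := fun ε hε => by
    have : Tendsto (fun h : ℂ => 4 * M * ‖v‖ ^ 2 / r ^ 2 * ‖h‖) (𝓝 0)
        (𝓝 (4 * M * ‖v‖ ^ 2 / r ^ 2 * ‖(0 : ℂ)‖)) := Continuous.tendsto (by fun_prop) 0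
    exact nhdsWithin_le_nhds (this.eventually (gt_mem_nhds (by simpa using hε)))
  refine differentiableAt_of_tendstoUniformlyOn_ball (l := 𝓝[≠] (0 : ℂ))
    (u := fun h z => h⁻¹ • (f (z + h • v) - f z)) (M := 2 * M / r * ‖v‖ + 1) hr ?_ ?_
  · filter_upwards [hest, hsmall 1 one_pos] with h hh hs
    refine ⟨?_, fun z hz => ?_⟩
    · refine DifferentiableOn.const_smul (DifferentiableOn.sub ?_ ?_) _
      · exact hd.comp (by fun_prop) fun z hz => hsub z hz (hh z hz).1
      · exact hd.mono (ball_subset_ball (by linarith))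
    · have h1 := (ContinuousLinearMap.le_opNorm (fderiv ℂ f z) v).trans
        (mul_le_mul_of_nonneg_right (norm_fderiv_le_of_norm_le_ball hr (hd.mono (hsub z hz))
          (fun w hw => (hball w (hsub z hz hw)).2)) (norm_nonneg v))
      have h2 := norm_le_norm_sub_add (h⁻¹ • (f (z + h • v) - f z)) (fderiv ℂ f z v)
      linarith [(hh z hz).2]
  · rw [Metric.tendstoUniformlyOn_iff]
    intro ε hε
    filter_upwards [hest, hsmall ε hε] with h hh hs z hz
    rw [dist_comm, dist_eq_norm]
    exact (hh z hz).2.trans_lt hs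

/-- A holomorphic map on an open subset of a finite-dimensional space is continuously
differentiable. -/
theorem DifferentiableOn.contDiffOn_one [FiniteDimensional ℂ E] [CompleteSpace F] {f : E → F}
    {U : Set E} (hU : IsOpen U) (hf : DifferentiableOn ℂ f U) : ContDiffOn ℂ 1 f U := by
  rw [← zero_add (1 : WithTop ℕ∞), contDiffOn_succ_iff_fderiv_of_isOpen hU, contDiffOn_zero]
  exact ⟨hf, by simp, continuousOn_clm_apply.2 fun v => (hf.fderiv_apply_const hU v).continuousOn⟩

end SeveralVariables

/-! ### Zero sets of holomorphic functions of two variables -/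

section ZeroSet

/-- The iterated partial derivative `∂ᵏg/∂wᵏ` of a function `g` of two complex variables
`(x, w)`. -/
noncomputable def iteratedPartialSnd (g : ℂ × ℂ → ℂ) : ℕ → ℂ × ℂ → ℂ
  | 0 => g
  | k + 1 => fun p => fderiv ℂ (iteratedPartialSnd g k) p (0, 1)

variable {g : ℂ × ℂ → ℂ} {Ω : Set (ℂ × ℂ)}

theorem differentiableOn_iteratedPartialSnd (hΩ : IsOpen Ω) (hg : DifferentiableOn ℂ g Ω) (k : ℕ) :
    DifferentiableOn ℂ (iteratedPartialSnd g k) Ω := by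
  induction k with
  | zero => exact hg
  | succ k ih => exact ih.fderiv_apply_const hΩ (0, 1)

theorem hasDerivAt_iteratedPartialSnd (hΩ : IsOpen Ω) (hg : DifferentiableOn ℂ g Ω) (k : ℕ)
    {x w : ℂ} (hp : (x, w) ∈ Ω) :
    HasDerivAt (fun w => iteratedPartialSnd g k (x, w))
      (iteratedPartialSnd g (k + 1) (x, w)) w := by
  have h1 := ((differentiableOn_iteratedPartialSnd hΩ hg k).differentiableAt
    (hΩ.mem_nhds hp)).hasFDerivAt
  exact h1.comp_hasDerivAt w ((hasDerivAt_const w x).prodMk (hasDerivAt_id w))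

theorem iteratedDeriv_eq_iteratedPartialSnd (hΩ : IsOpen Ω) (hg : DifferentiableOn ℂ g Ω) (k : ℕ)
    {x w : ℂ} (hp : (x, w) ∈ Ω) :
    iteratedDeriv k (fun w => g (x, w)) w = iteratedPartialSnd g k (x, w) := by
  induction k generalizing w with
  | zero => rfl
  | succ k ih =>
    rw [iteratedDeriv_succ, ← (hasDerivAt_iteratedPartialSnd hΩ hg k hp).deriv]
    refine Filter.EventuallyEq.deriv_eq ?_
    have : ∀ᶠ v in 𝓝 w, (x, v) ∈ Ω :=
      (Continuous.prodMk_right x).continuousAt.eventually (hΩ.mem_nhds hp)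
    filter_upwards [this] with v hv using ih hv

/-- A one-variable consequence of the maximum principle for `1/h`. -/
theorem exists_zero_mem_ball_of_norm_lt {h : ℂ → ℂ} {w₀ : ℂ} {ε δ : ℝ} (hε : 0 < ε)
    (hh : DifferentiableOn ℂ h (closedBall w₀ ε)) (hδ : ∀ w ∈ sphere w₀ ε, δ ≤ ‖h w‖)
    (h0 : ‖h w₀‖ < δ) : ∃ w ∈ ball w₀ ε, h w = 0 := by
  by_contra! hne
  have hδ0 : 0 < δ := (norm_nonneg _).trans_lt h0
  have hne' : ∀ w ∈ closedBall w₀ ε, h w ≠ 0 := fun w hw => by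
    rcases (mem_closedBall.1 hw).lt_or_eq with hlt | heq
    · exact hne w hlt
    · exact norm_pos_iff.1 (hδ0.trans_le (hδ w heq))
  have hd : DiffContOnCl ℂ (fun w => (h w)⁻¹) (ball w₀ ε) := by
    refine DifferentiableOn.diffContOnCl ?_
    rw [closure_ball _ hε.ne']
    exact hh.inv hne'
  have := Complex.norm_le_of_forall_mem_frontier_norm_le isBounded_ball hd (C := δ⁻¹)
    (fun w hw => ?_) (subset_closure (mem_ball_self hε))
  · rw [norm_inv, inv_le_inv₀ (norm_pos_iff.2 (hne w₀ (mem_ball_self hε))) hδ0] at this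
    linarith
  · rw [frontier_ball _ hε.ne'] at hw
    rw [norm_inv]
    exact inv_anti₀ hδ0 (hδ w hw)

/-- The zero set of a holomorphic function of two variables contains the graph of a
holomorphic function near one of its points. That point is chosen so that the multiplicity of the
zero in the second variable is minimal, so that it is constant nearby. -/
theorem exists_graph_subset_zeros (hΩ : IsOpen Ω) (hg : DifferentiableOn ℂ g Ω)
    (h0 : (0, 0) ∈ Ω) (hg0 : g (0, 0) = 0) {k : ℕ} (hk : iteratedPartialSnd g k (0, 0) ≠ 0) :
    ∃ (x₀ : ℂ) (ψ : ℂ → ℂ), ∀ᶠ x in 𝓝 x₀, (x, ψ x) ∈ Ω ∧ g (x, ψ x) = 0 ∧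
      DifferentiableAt ℂ ψ x := by
  classical
  have hex : ∃ m, ∃ p ∈ Ω, g p = 0 ∧ iteratedPartialSnd g m p ≠ 0 := ⟨k, _, h0, hg0, hk⟩
  obtain ⟨⟨x₀, w₀⟩, hpΩ, hgp, hm⟩ := Nat.find_spec hex
  have hmin : ∀ j < Nat.find hex, ∀ p ∈ Ω, g p = 0 → iteratedPartialSnd g j p = 0 := by
    intro j hj p hp hgp
    by_contra hne
    exact Nat.find_min hex hj ⟨p, hp, hgp, hne⟩
  generalize Nat.find hex = m at hm hmin
  obtain ⟨m, rfl⟩ : ∃ j, m = j + 1 := by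
    refine Nat.exists_eq_succ_of_ne_zero ?_
    rintro rfl
    exact hm hgp
  -- Near `(x₀, w₀)` the zeros of `D = ∂ᵐg/∂wᵐ` form the graph of a function `ψ`.
  set D := iteratedPartialSnd g m with hD
  have hDp : D (x₀, w₀) = 0 := hmin m (Nat.lt_succ_self m) _ hpΩ hgp
  have hDc : ContDiffAt ℂ 1 D (x₀, w₀) :=
    ((differentiableOn_iteratedPartialSnd hΩ hg m).contDiffOn_one hΩ).contDiffAt (hΩ.mem_nhds hpΩ)
  have hinv : (fderiv ℂ D (x₀, w₀) ∘L .inr ℂ ℂ ℂ).IsInvertible := by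
    have hne : fderiv ℂ D (x₀, w₀) (0, 1) ≠ 0 := hm
    refine ⟨ContinuousLinearEquiv.unitsEquivAut ℂ (Units.mk0 _ hne), ?_⟩
    ext
    simp
  set ψ := hDc.implicitFunction one_ne_zero hinv with hψ
  have hψ0 : ψ x₀ = w₀ := hDc.implicitFunction_apply_self one_ne_zero hinv
  have hiff := hDc.eventually_apply_eq_iff_implicitFunction one_ne_zero hinv
  have hψd : ContDiffAt ℂ 1 ψ x₀ := hDc.contDiffAt_implicitFunction one_ne_zero hinv
  have hψe : ∀ᶠ x in 𝓝 x₀, DifferentiableAt ℂ ψ x :=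
    (hψd.eventually (by simp)).mono fun x hx => hx.differentiableAt one_ne_zero
  have hgood : ∀ᶠ p in 𝓝 (x₀, w₀), p ∈ Ω ∧ (D p = D (x₀, w₀) ↔ ψ p.1 = p.2) :=
    Filter.Eventually.and (hΩ.mem_nhds hpΩ) hiff
  rw [Metric.eventually_nhds_iff_ball] at hgood
  obtain ⟨ρ, hρ, hgood⟩ := hgood
  obtain ⟨ε, hε, hερ⟩ : ∃ ε, 0 < ε ∧ ε < ρ := ⟨ρ / 2, by positivity, by linarith⟩
  have hmem : ∀ x ∈ ball x₀ ρ, ∀ w ∈ closedBall w₀ ε, (x, w) ∈ ball (x₀, w₀) ρ := by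
    intro x hx w hw
    rw [← ball_prod_same]
    exact ⟨hx, closedBall_subset_ball hερ hw⟩
  -- On the circle `|w - w₀| = ε` the function `g (x, ·)` stays away from `0` for `x` near `x₀`.
  have hgc : ContinuousOn g Ω := hg.continuousOn
  have hslice : ∀ x ∈ ball x₀ ρ, DifferentiableOn ℂ (fun w => g (x, w)) (closedBall w₀ ε) :=
    fun x hx => hg.comp (by fun_prop) fun w hw => (hgood _ (hmem x hx w hw)).1
  obtain ⟨δ, hδ, hδs⟩ : ∃ δ, 0 < δ ∧ ∀ w ∈ sphere w₀ ε, δ < ‖g (x₀, w)‖ := by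
    have hcs : IsCompact (sphere w₀ ε) := isCompact_sphere w₀ ε
    obtain ⟨w₁, hw₁, hmin₁⟩ := hcs.exists_isMinOn (NormedSpace.sphere_nonempty.2 hε.le)
      (((hslice x₀ (mem_ball_self hρ)).continuousOn.mono sphere_subset_closedBall).norm)
    have hpos : 0 < ‖g (x₀, w₁)‖ := by
      rw [norm_pos_iff]
      intro hz
      have hG := hgood _ (hmem x₀ (mem_ball_self hρ) w₁ (sphere_subset_closedBall hw₁))
      have hD1 : D (x₀, w₁) = 0 := hmin m (Nat.lt_succ_self m) _ hG.1 hz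
      have : ψ x₀ = w₁ := hG.2.1 (hD1.trans hDp.symm)
      rw [hψ0] at this
      rw [← this, mem_sphere, dist_self] at hw₁
      exact hε.ne hw₁
    exact ⟨‖g (x₀, w₁)‖ / 2, by positivity, fun w hw =>
      (half_lt_self hpos).trans_le (hmin₁ hw)⟩
  have hclose : ∀ᶠ x in 𝓝 x₀, ∀ w ∈ sphere w₀ ε, δ < ‖g (x, w)‖ := by
    refine (isCompact_sphere w₀ ε).eventually_forall_of_forall_eventually fun w hw => ?_
    have hcw : ContinuousAt g (x₀, w) := hgc.continuousAt (hΩ.mem_nhds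
      (hgood _ (hmem x₀ (mem_ball_self hρ) w (sphere_subset_closedBall hw))).1)
    exact hcw.norm.eventually (lt_mem_nhds (hδs w hw))
  have hcenter : ∀ᶠ x in 𝓝 x₀, ‖g (x, w₀)‖ < δ := by
    have hc : ContinuousAt (fun x => g (x, w₀)) x₀ :=
      ContinuousAt.comp (f := fun x => (x, w₀)) (hgc.continuousAt (hΩ.mem_nhds hpΩ))
        (by fun_prop)
    refine hc.norm.eventually (gt_mem_nhds ?_)
    simpa [hgp] using hδ
  refine ⟨x₀, ψ, ?_⟩
  filter_upwards [hclose, hcenter, hψe, ball_mem_nhds x₀ hρ] with x h1 h2 h3 h4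
  obtain ⟨w, hw, hgw⟩ := exists_zero_mem_ball_of_norm_lt hε (hslice x h4) (fun w hw => (h1 w hw).le)
    h2
  have hG := hgood _ (hmem x h4 w (ball_subset_closedBall hw))
  have : ψ x = w := hG.2.1 ((hmin m (Nat.lt_succ_self m) _ hG.1 hgw).trans hDp.symm)
  exact ⟨this ▸ hG.1, this ▸ hgw, h3⟩

end ZeroSet

/-! ### Osgood's theorem on injective holomorphic maps -/

section Osgood

/-- The one-variable case: the inverse of an injective holomorphic function is continuous by the
open mapping theorem and holomorphic off the isolated critical values, so these are removable. -/
theorem deriv_ne_zero_of_injOn {f : ℂ → ℂ} {U : Set ℂ} (hU : IsOpen U)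
    (hf : DifferentiableOn ℂ f U) (hinj : InjOn f U) {p : ℂ} (hp : p ∈ U) : deriv f p ≠ 0 := by
  intro hzero
  have hne : ∀ z ∈ U, ¬ ∀ᶠ w in 𝓝 z, f w = f z := by
    intro z hz hc
    have h1 : ∀ᶠ w in 𝓝[≠] z, w = z := by
      filter_upwards [nhdsWithin_le_nhds hc, nhdsWithin_le_nhds (hU.mem_nhds hz)] with w hw hwU
      exact hinj hwU hz hw
    obtain ⟨w, hw, hw'⟩ := (h1.and self_mem_nhdsWithin).exists
    exact hw' hw
  have hopen : ∀ z ∈ U, 𝓝 (f z) ≤ map f (𝓝 z) := fun z hz =>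
    (((hf.analyticAt (hU.mem_nhds hz))).eventually_constant_or_nhds_le_map_nhds).resolve_left
      (hne z hz)
  set g := Function.invFunOn f U
  have hgf : ∀ z ∈ U, g (f z) = z := fun z hz => hinj.leftInvOn_invFunOn hz
  have hgc : ∀ z ∈ U, ContinuousAt g (f z) := by
    intro z hz
    rw [ContinuousAt, hgf z hz]
    refine Tendsto.mono_left ?_ (hopen z hz)
    rw [tendsto_map'_iff]
    refine tendsto_id.congr' ?_
    filter_upwards [hU.mem_nhds hz] with w hw using (hgf w hw).symm
  have hgd : ∀ z ∈ U, deriv f z ≠ 0 → DifferentiableAt ℂ g (f z) := by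
    intro z hz hdz
    refine (HasDerivAt.of_local_left_inverse (f := f) (f' := deriv f z) (hgc z hz) ?_ hdz ?_
      ).differentiableAt
    · rw [hgf z hz]
      exact (hf.differentiableAt (hU.mem_nhds hz)).hasDerivAt
    · refine hopen z hz ?_
      rw [mem_map]
      filter_upwards [hU.mem_nhds hz] with w hw
      simp [hgf w hw]
  have hdf : AnalyticAt ℂ (deriv f) p := (hf.analyticAt (hU.mem_nhds hp)).deriv
  have hiso : ∀ᶠ z in 𝓝[≠] p, deriv f z ≠ 0 := by
    refine hdf.eventually_eq_zero_or_eventually_ne_zero.resolve_left fun h0 => hne p hp ?_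
    obtain ⟨r, hr, hball⟩ := Metric.eventually_nhds_iff_ball.1
      (Filter.Eventually.and h0 (hU.mem_nhds hp))
    filter_upwards [ball_mem_nhds p hr] with w hw
    exact isOpen_ball.is_const_of_deriv_eq_zero (convex_ball p r).isPreconnected
      (hf.mono fun z hz => (hball z hz).2) (fun z hz => (hball z hz).1) hw (mem_ball_self hr)
  have hgan : AnalyticAt ℂ g (f p) := by
    refine Complex.analyticAt_of_differentiable_on_punctured_nhds_of_continuousAt ?_ (hgc p hp)
    rw [eventually_nhdsWithin_iff] at hiso ⊢
    refine hopen p hp ?_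
    rw [mem_map]
    filter_upwards [hiso, hU.mem_nhds hp] with z hz hzU hfz
    exact hgd z hzU (hz fun h => hfz (by rw [mem_singleton_iff] at h ⊢; rw [h]))
  have hcomp := hgan.differentiableAt.hasDerivAt.comp p
    (hf.differentiableAt (hU.mem_nhds hp)).hasDerivAt
  rw [hzero, mul_zero] at hcomp
  have hid : HasDerivAt (g ∘ f) 1 p := (hasDerivAt_id p).congr_of_eventuallyEq (by
    filter_upwards [hU.mem_nhds hp] with z hz using hgf z hz)
  exact zero_ne_one (hcomp.unique hid)

variable {E F : Type*} [NormedAddCommGroup E] [NormedSpace ℂ E] [NormedAddCommGroup F]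
  [NormedSpace ℂ F] [FiniteDimensional ℂ E] [FiniteDimensional ℂ F]

open Module in
theorem fderiv_ne_zero_of_injOn_of_finrank_eq_one (hE : finrank ℂ E = 1) (hF : finrank ℂ F = 1)
    {f : E → F} {U : Set E} (hU : IsOpen U) (hf : DifferentiableOn ℂ f U) (hinj : InjOn f U)
    {p : E} (hp : p ∈ U) : fderiv ℂ f p ≠ 0 := by
  have hC : finrank ℂ ℂ = 1 := finrank_self ℂ
  let e : ℂ ≃L[ℂ] E := ContinuousLinearEquiv.ofFinrankEq (hC.trans hE.symm)
  let e' : F ≃L[ℂ] ℂ := ContinuousLinearEquiv.ofFinrankEq (hF.trans hC.symm)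
  intro h0
  have hfp : HasFDerivAt f (0 : E →L[ℂ] F) (e (e.symm p)) := by
    rw [e.apply_symm_apply, ← h0]
    exact (hf.differentiableAt (hU.mem_nhds hp)).hasFDerivAt
  have hd : HasFDerivAt (e' ∘ f ∘ e) (0 : ℂ →L[ℂ] ℂ) (e.symm p) := by
    simpa using e'.hasFDerivAt.comp _ (hfp.comp (e.symm p) e.hasFDerivAt)
  refine deriv_ne_zero_of_injOn (f := e' ∘ f ∘ e) (p := e.symm p) (U := e ⁻¹' U)
    (hU.preimage e.continuous) ?_ ?_ (by simpa using hp) ?_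
  · exact e'.differentiable.comp_differentiableOn (hf.comp e.differentiable.differentiableOn
      (mapsTo_preimage e U))
  · exact e'.injective.comp_injOn (hinj.comp e.injective.injOn (mapsTo_preimage e U))
  · simpa using hd.hasDerivAt.deriv

open Module in
/-- The core of Osgood's theorem. If the derivative of a holomorphic map is everywhere zero or
injective, it vanishes on the zero set of its Jacobian determinant; in dimension at least two
this zero set contains a curve, along which the map is constant. -/
theorem fderiv_ne_zero_of_injOn_of_dichotomy {n : ℕ} (hn : 2 ≤ n) (hE : finrank ℂ E = n)
    (hF : finrank ℂ F = n) {f : E → F} {U : Set E} (hU : IsOpen U) (hf : DifferentiableOn ℂ f U)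
    (hinj : InjOn f U)
    (hdich : ∀ z ∈ U, fderiv ℂ f z = 0 ∨ Function.Injective (fderiv ℂ f z))
    {p : E} (hp : p ∈ U) : fderiv ℂ f p ≠ 0 := by
  intro hp0
  have hnt : Nontrivial E := nontrivial_of_finrank_pos (R := ℂ) (by omega)
  let bE : Basis (Fin n) ℂ E := finBasisOfFinrankEq ℂ E hE
  let bF : Basis (Fin n) ℂ F := finBasisOfFinrankEq ℂ F hF
  set G : E → ℂ := fun z => (LinearMap.toMatrix bE bF (fderiv ℂ f z : E →ₗ[ℂ] F)).det with hG
  have hGd : DifferentiableOn ℂ G U := by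
    have hent : ∀ i j, DifferentiableOn ℂ
        (fun z => LinearMap.toMatrix bE bF (fderiv ℂ f z : E →ₗ[ℂ] F) i j) U := by
      intro i j
      have h1 := hf.fderiv_apply_const hU (bE j)
      have h2 : DifferentiableOn ℂ
          (fun z => LinearMap.toContinuousLinearMap (bF.coord i) (fderiv ℂ f z (bE j))) U :=
        (ContinuousLinearMap.differentiable _).comp_differentiableOn h1
      refine h2.congr fun z _ => ?_
      simp [LinearMap.toMatrix_apply]
    simp only [hG, Matrix.det_apply]
    refine DifferentiableOn.fun_sum fun σ _ => DifferentiableOn.const_smul ?_ _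
    exact fun z hz => (HasFDerivWithinAt.finsetProd fun i _ =>
      (hent (σ i) i z hz).hasFDerivWithinAt).differentiableWithinAt
  have hG0 : ∀ z ∈ U, G z = 0 → fderiv ℂ f z = 0 := by
    intro z hz hGz
    refine (hdich z hz).resolve_right fun hi => ?_
    have hu := LinearEquiv.isUnit_det
      (LinearEquiv.ofInjectiveOfFinrankEq (fderiv ℂ f z : E →ₗ[ℂ] F) hi (hE.trans hF.symm)) bE bF
    exact hu.ne_zero hGz
  have hGp : G p = 0 := by
    have : Nonempty (Fin n) := ⟨⟨0, by omega⟩⟩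
    simp [hG, hp0]
  obtain ⟨R, hR, hball⟩ := Metric.isOpen_iff.1 hU p hp
  -- A point of the ball where the determinant does not vanish.
  obtain ⟨z₁, hz₁, hGz₁⟩ : ∃ z ∈ ball p R, G z ≠ 0 := by
    by_contra! hall
    obtain ⟨v, hv⟩ := exists_ne (0 : E)
    have hvn : 0 < ‖v‖ := norm_pos_iff.2 hv
    have hmem : p + ((R / (2 * ‖v‖) : ℝ) : ℂ) • v ∈ ball p R := by
      rw [mem_ball, dist_eq_norm, add_sub_cancel_left, norm_smul, Complex.norm_real,
        Real.norm_of_nonneg (by positivity)]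
      field_simp
      linarith
    let _ : NormedSpace ℝ E := NormedSpace.restrictScalars ℝ ℂ E
    have hc := isOpen_ball.is_const_of_fderiv_eq_zero (convex_ball p R).isPreconnected
      (hf.mono hball) (fun z hz => hG0 z (hball hz) (hall z hz)) hmem (mem_ball_self hR)
    have := hinj (hball hmem) hp hc
    simp [hv, hR.ne'] at this
  set e := z₁ - p with he
  have hee : e ≠ 0 := fun h => hGz₁ (by rw [sub_eq_zero.1 h]; exact hGp)
  obtain ⟨u, hu⟩ : ∃ u, u ∉ Submodule.span ℂ {e} := by
    by_contra! hall
    have h1 : finrank ℂ E ≤ 1 := by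
      refine finrank_le_one e fun w => ?_
      exact Submodule.mem_span_singleton.1 (hall w)
    omega
  set σ : ℂ × ℂ → E := fun q => p + q.1 • u + q.2 • e with hσ
  have hσd : Differentiable ℂ σ := by fun_prop
  have hΩ : IsOpen (σ ⁻¹' U) := hU.preimage hσd.continuous
  have hgd : DifferentiableOn ℂ (G ∘ σ) (σ ⁻¹' U) :=
    hGd.comp hσd.differentiableOn (mapsTo_preimage _ _)
  have hσ0 : σ (0, 0) = p := by simp [hσ]
  have h0mem : ((0, 0) : ℂ × ℂ) ∈ σ ⁻¹' U := by rw [mem_preimage, hσ0]; exact hp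
  obtain ⟨k, hk⟩ : ∃ k, iteratedPartialSnd (G ∘ σ) k (0, 0) ≠ 0 := by
    by_contra! hall
    have hen : 0 < ‖e‖ := norm_pos_iff.2 hee
    have hsl : ∀ w ∈ ball (0 : ℂ) (R / ‖e‖), σ (0, w) ∈ U := by
      intro w hw
      refine hball ?_
      rw [mem_ball_zero_iff, lt_div_iff₀ hen] at hw
      simpa [hσ, mem_ball, dist_eq_norm, norm_smul] using hw
    have hd : DifferentiableOn ℂ (fun w => (G ∘ σ) (0, w)) (ball 0 (R / ‖e‖)) :=
      hgd.comp (by fun_prop) hsl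
    have h1 : (1 : ℂ) ∈ ball (0 : ℂ) (R / ‖e‖) := by
      rw [mem_ball_zero_iff, norm_one, lt_div_iff₀ hen, one_mul]
      rwa [mem_ball, dist_eq_norm] at hz₁
    have hs := Complex.hasSum_taylorSeries_on_ball hd h1
    have hz : ∀ k, iteratedDeriv k (fun w => (G ∘ σ) (0, w)) 0 = 0 := fun k => by
      rw [iteratedDeriv_eq_iteratedPartialSnd hΩ hgd k h0mem, hall k]
    simp only [hz, smul_zero] at hs
    have := hs.unique hasSum_zero
    simp [hσ, he] at this
    exact hGz₁ this
  obtain ⟨x₀, ψ, hψ⟩ := exists_graph_subset_zeros hΩ hgd h0mem (by simp [hσ0, hGp]) hk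
  obtain ⟨η, hη, hψ⟩ := Metric.eventually_nhds_iff_ball.1 hψ
  -- Along the curve `x ↦ σ (x, ψ x)` the derivative of `f` vanishes.
  have hderiv : ∀ x ∈ ball x₀ η, HasDerivAt (fun x => f (σ (x, ψ x))) 0 x := by
    intro x hx
    obtain ⟨hxU, hx0, hxd⟩ := hψ x hx
    have h1 : HasFDerivAt f (0 : E →L[ℂ] F) (σ (x, ψ x)) := by
      rw [← hG0 _ hxU hx0]
      exact (hf.differentiableAt (hU.mem_nhds hxU)).hasFDerivAt
    have h2 : DifferentiableAt ℂ (fun x => σ (x, ψ x)) x := by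
      simp only [hσ]; fun_prop
    have h3 := h1.comp_hasDerivAt x h2.hasDerivAt
    rwa [zero_apply] at h3
  have hx₁ : x₀ + ((η / 2 : ℝ) : ℂ) ∈ ball x₀ η := by
    rw [mem_ball, dist_eq_norm, add_sub_cancel_left, Complex.norm_real,
      Real.norm_of_nonneg (by positivity)]
    linarith
  have hconst := isOpen_ball.is_const_of_deriv_eq_zero (convex_ball x₀ η).isPreconnected
    (fun x hx => (hderiv x hx).differentiableAt.differentiableWithinAt)
    (fun x hx => (hderiv x hx).deriv) hx₁ (mem_ball_self hη)
  have heq := hinj (hψ _ hx₁).1 (hψ _ (mem_ball_self hη)).1 hconst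
  refine hu (Submodule.mem_span_singleton.2
    ⟨((η / 2 : ℝ) : ℂ)⁻¹ * (ψ x₀ - ψ (x₀ + ((η / 2 : ℝ) : ℂ))), ?_⟩)
  have hη0 : ((η / 2 : ℝ) : ℂ) ≠ 0 := by
    rw [Complex.ofReal_ne_zero]; positivity
  generalize ((η / 2 : ℝ) : ℂ) = t at *
  rw [mul_smul, inv_smul_eq_iff₀ hη0, sub_smul]
  simp only [hσ, add_smul] at heq
  have h3 : p + (x₀ • u + t • u) + ψ (x₀ + t) • e - (p + x₀ • u + ψ (x₀ + t) • e)
    = p + x₀ • u + ψ x₀ • e - (p + x₀ • u + ψ (x₀ + t) • e) := by rw [heq]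
  have h4 : t • u = ψ x₀ • e - ψ (x₀ + t) • e := by
    calc t • u = p + (x₀ • u + t • u) + ψ (x₀ + t) • e - (p + x₀ • u + ψ (x₀ + t) • e) := by abel
      _ = _ := by rw [h3]; abel
  exact h4.symm

end Osgood

open Module in
/-- **Osgood's theorem**: an injective holomorphic map between spaces of the same finite dimension
has an injective derivative at every point. Where the derivative is nonzero, some component of
the map is a submersion, and the restriction of the map to its level set lowers the dimension. -/
theorem fderiv_injective_of_injOn.{u, v} (n : ℕ) : ∀ (E : Type u) (F : Type v)
    [NormedAddCommGroup E] [NormedSpace ℂ E] [NormedAddCommGroup F] [NormedSpace ℂ F]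
    [FiniteDimensional ℂ E] [FiniteDimensional ℂ F], finrank ℂ E = n → finrank ℂ F = n →
    ∀ (f : E → F) (U : Set E), IsOpen U → DifferentiableOn ℂ f U → InjOn f U →
    ∀ p ∈ U, Function.Injective (fderiv ℂ f p) := by
  induction n with
  | zero =>
    intro E F _ _ _ _ _ _ hE _ f U _ _ _ p _
    have : Subsingleton E := finrank_zero_iff.1 hE
    exact Function.injective_of_subsingleton _
  | succ n ih =>
    intro E F _ _ _ _ _ _ hE hF f U hU hf hinj
    have hdich : ∀ z ∈ U, fderiv ℂ f z = 0 ∨ Function.Injective (fderiv ℂ f z) := by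
      intro z hz
      refine or_iff_not_imp_left.2 fun hA => ?_
      set A := fderiv ℂ f z with hAdef
      obtain ⟨v₀, hv₀⟩ : ∃ v, A v ≠ 0 := by
        by_contra! h; exact hA (ContinuousLinearMap.ext h)
      obtain ⟨ℓ, hℓ⟩ := SeparatingDual.exists_ne_zero (R := ℂ) hv₀
      set h' : E →L[ℂ] ℂ := ℓ ∘L A with hh'
      have hv₀' : h' v₀ ≠ 0 := hℓ
      let K : Submodule ℂ E := LinearMap.ker (h' : E →ₗ[ℂ] ℂ)
      let L : Submodule ℂ F := LinearMap.ker (ℓ : F →ₗ[ℂ] ℂ)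
      have hKmem : ∀ y : K, h' y = 0 := fun y => y.2
      have hKfin : finrank ℂ K = n := by
        have := Module.Dual.finrank_ker_add_one_of_ne_zero (f := (h' : E →ₗ[ℂ] ℂ))
          (fun h => hv₀' (by simpa using LinearMap.congr_fun h v₀))
        have h2 : finrank ℂ K + 1 = finrank ℂ E := this
        omega
      have hLfin : finrank ℂ L = n := by
        have := Module.Dual.finrank_ker_add_one_of_ne_zero (f := (ℓ : F →ₗ[ℂ] ℂ))
          (fun h => hℓ (by simpa using LinearMap.congr_fun h (A v₀)))
        have h2 : finrank ℂ L + 1 = finrank ℂ F := this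
        omega
      -- The level set of `ℓ ∘ f` through `z` is parametrized by `y ↦ z + y + ψ y • v₀`.
      set s : K × ℂ → E := fun q => z + (q.1 : E) + q.2 • v₀ with hs
      have hsd : ∀ q, HasFDerivAt s
          (K.subtypeL ∘L .fst ℂ K ℂ + (ContinuousLinearMap.snd ℂ K ℂ).smulRight v₀) q := by
        intro q
        have h1 : HasFDerivAt (fun q : K × ℂ => K.subtypeL q.1) (K.subtypeL ∘L .fst ℂ K ℂ) q :=
          (K.subtypeL ∘L .fst ℂ K ℂ).hasFDerivAt
        have h2 : HasFDerivAt (fun q : K × ℂ => q.2 • v₀)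
          ((ContinuousLinearMap.snd ℂ K ℂ).smulRight v₀) q :=
          ((ContinuousLinearMap.snd ℂ K ℂ).smulRight v₀).hasFDerivAt
        exact (h1.const_add z).add h2
      have hsdiff : Differentiable ℂ s := fun q => (hsd q).differentiableAt
      have hs0 : s (0, 0) = z := by simp [hs]
      have hsU : IsOpen (s ⁻¹' U) := hU.preimage hsdiff.continuous
      have h0U : ((0, 0) : K × ℂ) ∈ s ⁻¹' U := by rw [mem_preimage, hs0]; exact hz
      set H : K × ℂ → ℂ := fun q => ℓ (f (s q)) with hH
      have hHd : DifferentiableOn ℂ H (s ⁻¹' U) :=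
        ℓ.differentiable.comp_differentiableOn (hf.comp hsdiff.differentiableOn
          (mapsTo_preimage _ _))
      have hHc : ContDiffAt ℂ 1 H (0, 0) :=
        (hHd.contDiffOn_one hsU).contDiffAt (hsU.mem_nhds h0U)
      have hfz : HasFDerivAt f A z := (hf.differentiableAt (hU.mem_nhds hz)).hasFDerivAt
      have hHf : fderiv ℂ H (0, 0)
          = h' ∘L (K.subtypeL ∘L .fst ℂ K ℂ + (ContinuousLinearMap.snd ℂ K ℂ).smulRight v₀) := by
        refine HasFDerivAt.fderiv ?_
        have h1 : HasFDerivAt f A (s (0, 0)) := by rw [hs0]; exact hfz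
        exact ℓ.hasFDerivAt.comp _ (h1.comp _ (hsd (0, 0)))
      have hinv : (fderiv ℂ H (0, 0) ∘L .inr ℂ K ℂ).IsInvertible := by
        refine ⟨ContinuousLinearEquiv.unitsEquivAut ℂ (Units.mk0 _ hv₀'), ?_⟩
        ext
        simp [hHf]
      set ψ := hHc.implicitFunction one_ne_zero hinv with hψ
      have hψ0 : ψ 0 = 0 := hHc.implicitFunction_apply_self one_ne_zero hinv
      have hψeq := hHc.eventually_apply_implicitFunction one_ne_zero hinv
      have hψc : ContDiffAt ℂ 1 ψ 0 := hHc.contDiffAt_implicitFunction one_ne_zero hinv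
      have hψ' : HasFDerivAt ψ (0 : K →L[ℂ] ℂ) 0 := by
        have h1 := (hHc.hasStrictFDerivAt_implicitFunction one_ne_zero hinv).hasFDerivAt
        have h2 : fderiv ℂ H (0, 0) ∘L .inl ℂ K ℂ = 0 := by
          ext y
          simp [hHf, hKmem]
        rwa [h2, ContinuousLinearMap.comp_zero, neg_zero] at h1
      set c : K → E := fun y => s (y, ψ y) with hc
      have hc0 : c 0 = z := by simp only [hc, hψ0]; exact hs0
      have hc' : HasFDerivAt c K.subtypeL 0 := by
        have h1 := (hsd (0, ψ 0)).comp (0 : K) ((hasFDerivAt_id (0 : K)).prodMk hψ')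
        refine h1.congr_fderiv ?_
        ext y
        simp
      have hcU : ∀ᶠ y in 𝓝 (0 : K), c y ∈ U :=
        hc'.continuousAt.eventually (hU.mem_nhds (by rw [hc0]; exact hz))
      have hev := ((hψc.eventually (by simp)).and hψeq).and hcU
      obtain ⟨η, hη, hev⟩ := Metric.eventually_nhds_iff_ball.1 hev
      obtain ⟨P, hP⟩ := Submodule.ClosedComplemented.of_finiteDimensional L
      set k : K → L := fun y => P (f (c y) - f z) with hk
      have hkL : ∀ y ∈ ball (0 : K) η, f (c y) - f z ∈ L := by
        intro y hy
        have h1 : ℓ (f (c y)) = ℓ (f (s (0, 0))) := (hev y hy).1.2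
        rw [hs0] at h1
        simp [L, h1]
      have hkd : DifferentiableOn ℂ k (ball 0 η) := by
        intro y hy
        have h1 : DifferentiableAt ℂ ψ y := (hev y hy).1.1.differentiableAt one_ne_zero
        have h2 : DifferentiableAt ℂ c y :=
          (hsdiff (y, ψ y)).comp (f := fun y => (y, ψ y)) y (differentiableAt_id.prodMk h1)
        have h3 : DifferentiableAt ℂ (fun y => f (c y)) y :=
          (hf.differentiableAt (hU.mem_nhds (hev y hy).2)).comp y h2
        exact (P.differentiableAt.comp y (h3.sub_const (f z))).differentiableWithinAt
      have hkinj : InjOn k (ball 0 η) := by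
        intro y hy y' hy' heq
        have h1 := hP ⟨_, hkL y hy⟩
        have h2 := hP ⟨_, hkL y' hy'⟩
        have h3 : f (c y) = f (c y') := by
          have : (⟨_, hkL y hy⟩ : L) = ⟨_, hkL y' hy'⟩ := h1.symm.trans (Eq.trans heq h2)
          simpa using this
        have h4 : s (y, ψ y) = s (y', ψ y') := hinj (hev y hy).2 (hev y' hy').2 h3
        simp only [hs, add_assoc, add_right_inj] at h4
        have h5 : ψ y = ψ y' := by
          have := congrArg h' h4
          simpa [hKmem, hv₀'] using this
        rw [h5, add_left_inj] at h4
        exact Subtype.ext h4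
      have hk' : HasFDerivAt k (P ∘L A ∘L K.subtypeL) 0 := by
        have h1 : HasFDerivAt f A (c 0) := by rw [hc0]; exact hfz
        exact P.hasFDerivAt.comp _ ((h1.comp _ hc').sub_const (f z))
      have hI := ih K L hKfin hLfin k (ball 0 η) isOpen_ball hkd hkinj 0 (mem_ball_self hη)
      rw [hk'.fderiv] at hI
      refine (injective_iff_map_eq_zero A).2 fun v hv => ?_
      have hvK : v ∈ K := by simp [K, hh', hv]
      have : (⟨v, hvK⟩ : K) = 0 := by
        refine (injective_iff_map_eq_zero _).1 hI _ ?_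
        simp [hv]
      simpa using this
    intro p hp
    refine (hdich p hp).resolve_left ?_
    rcases Nat.eq_zero_or_pos n with rfl | hn
    · exact fderiv_ne_zero_of_injOn_of_finrank_eq_one hE hF hU hf hinj hp
    · exact fderiv_ne_zero_of_injOn_of_dichotomy (by omega) hE hF hU hf hinj hdich hp

/-! ### Self-maps of the unit ball -/

section SelfMaps

variable {E : Type*} [NormedAddCommGroup E] [InnerProductSpace ℂ E] {φ : E → E} {lam : ℝ}

/-- For a holomorphic self-map `φ` of the unit ball with `φ 0 = 0` and `dφ₀ = λ id`, the
component of `w - φ w` in the direction `w` is of order `1 - λ`. On the complex line through `w`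
this is Harnack's inequality for the function `1 - ⟨u, φ (ζ u)⟩ / ζ` of nonnegative real part. -/
theorem norm_inner_sub_le_of_mapsTo_unitBall (hd : DifferentiableOn ℂ φ (ball 0 1))
    (hm : MapsTo φ (ball 0 1) (ball 0 1)) (h0 : φ 0 = 0)
    (h0' : fderiv ℂ φ 0 = (lam : ℂ) • ContinuousLinearMap.id ℂ E) (hlam : lam ≤ 1)
    {w : E} (hw : w ∈ ball (0 : E) 1) :
    ‖inner ℂ w (w - φ w)‖ ≤ (1 - lam) * ((1 + ‖w‖) / (1 - ‖w‖)) := by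
  have hw1 : ‖w‖ < 1 := by simpa using hw
  rcases eq_or_ne w 0 with rfl | hw0
  · simpa using hlam
  have hwn : 0 < ‖w‖ := norm_pos_iff.2 hw0
  set u : E := ((‖w‖⁻¹ : ℝ) : ℂ) • w with hu
  have hun : ‖u‖ = 1 := by
    rw [hu, norm_smul, Complex.norm_real, norm_inv, norm_norm, inv_mul_cancel₀ hwn.ne']
  have hmem : ∀ ζ ∈ ball (0 : ℂ) 1, ζ • u ∈ ball (0 : E) 1 := by
    intro ζ hζ
    rw [mem_ball_zero_iff] at hζ ⊢
    rwa [norm_smul, hun, mul_one]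
  set k : ℂ → ℂ := fun ζ => innerSL ℂ u (φ (ζ • u)) with hk
  have hkd : DifferentiableOn ℂ k (ball 0 1) :=
    (innerSL ℂ u).differentiable.comp_differentiableOn (hd.comp (by fun_prop) hmem)
  have hk0 : k 0 = 0 := by simp [hk, h0]
  have hkm : MapsTo k (ball 0 1) (closedBall (k 0) 1) := by
    intro ζ hζ
    rw [hk0, mem_closedBall_zero_iff]
    refine (norm_inner_le_norm u _).trans ?_
    rw [hun, one_mul]
    exact (mem_ball_zero_iff.1 (hm (hmem ζ hζ))).le
  have hkderiv : HasDerivAt k lam 0 := by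
    have h1 : HasFDerivAt φ (fderiv ℂ φ 0) ((0 : ℂ) • u) := by
      rw [zero_smul]
      exact (hd.differentiableAt (ball_mem_nhds _ one_pos)).hasFDerivAt
    have h2 : HasDerivAt (fun ζ : ℂ => ζ • u) ((1 : ℂ) • u) 0 := (hasDerivAt_id 0).smul_const u
    have h3 := (innerSL ℂ u).hasFDerivAt.comp_hasDerivAt (0 : ℂ) (h1.comp_hasDerivAt (0 : ℂ) h2)
    refine h3.congr_deriv ?_
    rw [h0']
    simp [inner_self_eq_norm_sq_to_K, hun]
  have hζ : ((‖w‖ : ℝ) : ℂ) ∈ ball (0 : ℂ) 1 := by simpa using hw1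
  have hq : DifferentiableOn ℂ (fun ζ => dslope k 0 ζ - 1) (ball 0 1) :=
    ((Complex.differentiableOn_dslope (ball_mem_nhds (0 : ℂ) one_pos)).2 hkd).sub_const 1
  have hre : ∀ ζ ∈ ball (0 : ℂ) 1, (dslope k 0 ζ - 1).re ≤ 0 := by
    intro ζ hζ
    have h1 := Complex.norm_dslope_le_div_of_mapsTo_ball hkd hkm hζ
    have h2 := Complex.re_le_norm (dslope k 0 ζ)
    rw [div_one] at h1
    rw [Complex.sub_re, Complex.one_re]
    linarith
  -- Borel-Carathéodory with a bound `M` tending to `0` is Harnack's inequality.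
  have hbc : ‖dslope k 0 (‖w‖ : ℝ) - 1‖ ≤ (1 - lam) * ((1 + ‖w‖) / (1 - ‖w‖)) := by
    have hw1' : 0 < 1 - ‖w‖ := sub_pos.2 hw1
    have hlim : Tendsto (fun M : ℝ => 2 * M * ‖w‖ / (1 - ‖w‖) +
        (1 - lam) * ((1 + ‖w‖) / (1 - ‖w‖))) (𝓝[>] 0)
        (𝓝 (2 * 0 * ‖w‖ / (1 - ‖w‖) + (1 - lam) * ((1 + ‖w‖) / (1 - ‖w‖)))) :=
      (Continuous.tendsto (by fun_prop) 0).mono_left nhdsWithin_le_nhds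
    rw [mul_zero, zero_mul, zero_div, zero_add] at hlim
    refine ge_of_tendsto hlim ?_
    filter_upwards [self_mem_nhdsWithin] with M hM
    have h1 := Complex.borelCaratheodory (M := M) hM hq
      (fun ζ hζ => (hre ζ hζ).trans (le_of_lt hM)) one_pos hζ
    have h2 : ‖dslope k 0 0 - 1‖ = 1 - lam := by
      rw [dslope_same, hkderiv.deriv, ← Complex.ofReal_one, ← Complex.ofReal_sub,
        Complex.norm_real, Real.norm_eq_abs, abs_sub_comm, abs_of_nonneg (sub_nonneg.2 hlam)]
    rw [h2, Complex.norm_real, norm_norm, mul_div_assoc (1 - lam)] at h1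
    exact h1
  have hval : inner ℂ w (w - φ w) = -((‖w‖ ^ 2 : ℝ) : ℂ) * (dslope k 0 (‖w‖ : ℝ) - 1) := by
    have hwc : ((‖w‖ : ℝ) : ℂ) ≠ 0 := Complex.ofReal_ne_zero.2 hwn.ne'
    have h1 : ((‖w‖ : ℝ) : ℂ) • u = w := by
      rw [hu, smul_smul, Complex.ofReal_inv, mul_inv_cancel₀ hwc, one_smul]
    rw [dslope_of_ne _ hwc, slope_def_field, hk0, sub_zero, sub_zero]
    simp only [hk, h1, innerSL_apply_apply]
    rw [hu, inner_smul_left, inner_sub_right, inner_self_eq_norm_sq_to_K, Complex.conj_ofReal]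
    push_cast
    simp only [Complex.coe_algebraMap]
    field_simp
    ring
  rw [hval, norm_mul, norm_neg, Complex.norm_real, Real.norm_of_nonneg (by positivity)]
  calc ‖w‖ ^ 2 * _ ≤ 1 * ‖dslope k 0 (‖w‖ : ℝ) - 1‖ := by
        gcongr
        exact pow_le_one₀ hwn.le hw1.le
    _ ≤ _ := by rwa [one_mul]

/-- A constant `C r` with `‖z - φ z‖ ≤ C r * (1 - λ)` for `‖z‖ ≤ r`, valid for every holomorphic
self-map `φ` of the unit ball with `φ 0 = 0` and `dφ₀ = λ id`. -/
noncomputable def selfMapConst (r : ℝ) : ℝ := 2 * (3 + r) / (1 - r) ^ 2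

theorem selfMapConst_nonneg {r : ℝ} (hr : 0 ≤ r) : 0 ≤ selfMapConst r := by
  unfold selfMapConst; positivity

/-- With `h z = z - φ z`, the value `⟨y, h x⟩` is recovered from the values `⟨z, h z⟩` on the
circle `z = x + ζ y`, `|ζ| = ρ`: there `ζ ⟨z, h z⟩ = ζ ⟨x, h z⟩ + ρ² ⟨y, h z⟩`, which is
holomorphic in `ζ` with value `ρ² ⟨y, h x⟩` at `ζ = 0`. -/
theorem norm_sub_le_of_mapsTo_unitBall (hd : DifferentiableOn ℂ φ (ball 0 1))
    (hm : MapsTo φ (ball 0 1) (ball 0 1)) (h0 : φ 0 = 0)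
    (h0' : fderiv ℂ φ 0 = (lam : ℂ) • ContinuousLinearMap.id ℂ E) (hlam : lam ≤ 1)
    {r : ℝ} (hr : r < 1) {x : E} (hx : ‖x‖ ≤ r) :
    ‖x - φ x‖ ≤ selfMapConst r * (1 - lam) := by
  have hr0 : 0 ≤ r := (norm_nonneg x).trans hx
  have hlam' : 0 ≤ 1 - lam := sub_nonneg.2 hlam
  rcases eq_or_ne (x - φ x) 0 with hz | hz
  · rw [hz, norm_zero]
    exact mul_nonneg (selfMapConst_nonneg hr0) hlam'
  have hn : 0 < ‖x - φ x‖ := norm_pos_iff.2 hz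
  set y : E := ((‖x - φ x‖⁻¹ : ℝ) : ℂ) • (x - φ x) with hy
  have hyn : ‖y‖ = 1 := by
    rw [hy, norm_smul, Complex.norm_real, norm_inv, norm_norm, inv_mul_cancel₀ hn.ne']
  set ρ := (1 - r) / 2 with hρ
  have hρ0 : 0 < ρ := by rw [hρ]; linarith
  have hle : ∀ ζ ∈ closedBall (0 : ℂ) ρ, ‖x + ζ • y‖ ≤ (1 + r) / 2 := by
    intro ζ hζ
    rw [mem_closedBall_zero_iff] at hζ
    calc ‖x + ζ • y‖ ≤ ‖x‖ + ‖ζ • y‖ := norm_add_le _ _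
      _ ≤ r + ρ := by rw [norm_smul, hyn, mul_one]; gcongr
      _ = (1 + r) / 2 := by rw [hρ]; ring
  have hmem : ∀ ζ ∈ closedBall (0 : ℂ) ρ, x + ζ • y ∈ ball (0 : E) 1 := fun ζ hζ => by
    rw [mem_ball_zero_iff]; linarith [hle ζ hζ]
  set h : E → E := fun z => z - φ z with hh
  have hhd : DifferentiableOn ℂ (fun ζ : ℂ => h (x + ζ • y)) (closedBall 0 ρ) :=
    (differentiableOn_id.sub hd).comp (t := ball (0 : E) 1) (by fun_prop) hmem
  set G : ℂ → ℂ := fun ζ => ζ * innerSL ℂ x (h (x + ζ • y)) +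
    (ρ : ℂ) ^ 2 * innerSL ℂ y (h (x + ζ • y)) with hG
  have hGd : DifferentiableOn ℂ G (closedBall 0 ρ) := by
    refine (differentiableOn_id.mul ((innerSL ℂ x).differentiable.comp_differentiableOn hhd)).add
      (((innerSL ℂ y).differentiable.comp_differentiableOn hhd).const_mul _)
  have hbound : ‖G 0‖ ≤ ρ * ((1 - lam) * ((3 + r) / (1 - r))) := by
    refine Complex.norm_le_of_forall_mem_frontier_norm_le (U := ball (0 : ℂ) ρ) isBounded_ball
      (DifferentiableOn.diffContOnCl (by rwa [closure_ball _ hρ0.ne'])) (fun ζ hζ => ?_)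
      (subset_closure (mem_ball_self hρ0))
    rw [frontier_ball _ hρ0.ne', mem_sphere_zero_iff_norm] at hζ
    have hζc : ζ ∈ closedBall (0 : ℂ) ρ := by rw [mem_closedBall_zero_iff, hζ]
    have hGζ : G ζ = ζ * inner ℂ (x + ζ • y) (h (x + ζ • y)) := by
      have hconj : ζ * (starRingEnd ℂ) ζ = (ρ : ℂ) ^ 2 := by rw [Complex.mul_conj', hζ]
      simp only [hG, innerSL_apply_apply]
      rw [inner_add_left, inner_smul_left y _ ζ, mul_add, ← mul_assoc ζ ((starRingEnd ℂ) ζ), hconj]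
    rw [hGζ, norm_mul, hζ]
    gcongr
    refine (norm_inner_sub_le_of_mapsTo_unitBall hd hm h0 h0' hlam (hmem ζ hζc)).trans
      (mul_le_mul_of_nonneg_left ?_ hlam')
    have h1 := hle ζ hζc
    rw [div_le_div_iff₀ (by linarith) (by linarith)]
    nlinarith
  have hG0 : G 0 = (ρ : ℂ) ^ 2 * (‖x - φ x‖ : ℝ) := by
    simp only [hG, zero_mul, zero_smul, add_zero, zero_add, innerSL_apply_apply, hh]
    rw [hy, inner_smul_left, inner_self_eq_norm_sq_to_K, Complex.conj_ofReal]
    have : ((‖x - φ x‖ : ℝ) : ℂ) ≠ 0 := Complex.ofReal_ne_zero.2 hn.ne'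
    push_cast
    simp only [Complex.coe_algebraMap]
    field_simp
  rw [hG0, norm_mul, norm_pow, Complex.norm_real, Complex.norm_real, norm_norm,
    Real.norm_of_nonneg hρ0.le, sq, mul_assoc] at hbound
  have h2 := le_of_mul_le_mul_left hbound hρ0
  have h3 : ‖x - φ x‖ ≤ ρ⁻¹ * ((1 - lam) * ((3 + r) / (1 - r))) := by
    rwa [inv_mul_eq_div, le_div_iff₀ hρ0, mul_comm]
  refine h3.trans_eq ?_
  have : (1 - r) ≠ 0 := by linarith
  rw [hρ, selfMapConst]
  field_simp

end SelfMaps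

/-! ### Transition maps of a Loewner chain -/

namespace LoewnerBall

variable {n : ℕ} {f : ℝ → Cn n → Cn n}

/-- The transition map `φ_{s,t} = f_t⁻¹ ∘ f_s` of a Loewner chain, defined with the inverse of the
restriction of `f t` to the unit ball. -/
noncomputable def transition (f : ℝ → Cn n → Cn n) (s t : ℝ) (z : Cn n) : Cn n :=
  Function.invFunOn (f t) (unitBall n) (f s z)

namespace IsNormalizedLoewnerChain

variable {s t u : ℝ} {z : Cn n}

theorem transition_mem (hf : IsNormalizedLoewnerChain f) (hs : 0 ≤ s) (hst : s ≤ t)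
    (hz : z ∈ unitBall n) : transition f s t z ∈ unitBall n := by
  obtain ⟨φ, -, hm, -, he⟩ := hf.subordinate s t hs hst
  exact Function.invFunOn_mem ⟨φ z, hm hz, (he hz).symm⟩

theorem apply_transition (hf : IsNormalizedLoewnerChain f) (hs : 0 ≤ s) (hst : s ≤ t)
    (hz : z ∈ unitBall n) : f t (transition f s t z) = f s z := by
  obtain ⟨φ, -, hm, -, he⟩ := hf.subordinate s t hs hst
  exact Function.invFunOn_eq ⟨φ z, hm hz, (he hz).symm⟩

theorem transition_unique (hf : IsNormalizedLoewnerChain f) (hs : 0 ≤ s) (hst : s ≤ t)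
    (hz : z ∈ unitBall n) {w : Cn n} (hw : w ∈ unitBall n) (h : f t w = f s z) :
    transition f s t z = w :=
  hf.injOn t (hs.trans hst) (hf.transition_mem hs hst hz) hw
    ((hf.apply_transition hs hst hz).trans h.symm)

theorem transition_self (hf : IsNormalizedLoewnerChain f) (hs : 0 ≤ s) (hz : z ∈ unitBall n) :
    transition f s s z = z :=
  hf.transition_unique hs le_rfl hz hz rfl

theorem transition_zero (hf : IsNormalizedLoewnerChain f) (hs : 0 ≤ s) (hst : s ≤ t) :
    transition f s t 0 = 0 :=
  hf.transition_unique hs hst (mem_ball_self one_pos) (mem_ball_self one_pos) (by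
    rw [hf.map_zero s hs, hf.map_zero t (hs.trans hst)])

theorem transition_trans (hf : IsNormalizedLoewnerChain f) (hs : 0 ≤ s) (hst : s ≤ t)
    (htu : t ≤ u) (hz : z ∈ unitBall n) :
    transition f s u z = transition f t u (transition f s t z) := by
  have hz' := hf.transition_mem hs hst hz
  have ht := hs.trans hst
  exact hf.transition_unique hs (hst.trans htu) hz (hf.transition_mem ht htu hz')
    (by rw [hf.apply_transition ht htu hz', hf.apply_transition hs hst hz])

theorem differentiableOn_transition (hf : IsNormalizedLoewnerChain f) (hs : 0 ≤ s) (hst : s ≤ t) :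
    DifferentiableOn ℂ (transition f s t) (unitBall n) := by
  obtain ⟨φ, hd, hm, -, he⟩ := hf.subordinate s t hs hst
  exact hd.congr fun z hz => hf.transition_unique hs hst hz (hm hz) (he hz).symm

theorem fderiv_transition_zero (hf : IsNormalizedLoewnerChain f) (hs : 0 ≤ s) (hst : s ≤ t) :
    fderiv ℂ (transition f s t) 0
      = ((Real.exp (s - t) : ℝ) : ℂ) • ContinuousLinearMap.id ℂ (Cn n) := by
  have hB : unitBall n ∈ 𝓝 (0 : Cn n) := ball_mem_nhds _ one_pos
  have ht := hs.trans hst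
  have h1 := ((hf.differentiableOn_transition hs hst).differentiableAt hB).hasFDerivAt
  have h2 : HasFDerivAt (f t) (fderiv ℂ (f t) 0) (transition f s t 0) := by
    rw [hf.transition_zero hs hst]
    exact ((hf.holomorphic t ht).differentiableAt hB).hasFDerivAt
  have h3 := (h2.comp (0 : Cn n) h1).congr_of_eventuallyEq (f₁ := f s) (by
    filter_upwards [hB] with z hz using (hf.apply_transition hs hst hz).symm)
  have h4 := h3.fderiv
  rw [hf.fderiv_zero s hs, hf.fderiv_zero t ht, ContinuousLinearMap.smul_comp,
    ContinuousLinearMap.id_comp] at h4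
  have hne : ((Real.exp t : ℝ) : ℂ) ≠ 0 := Complex.ofReal_ne_zero.2 (Real.exp_pos t).ne'
  rw [← inv_smul_smul₀ hne (fderiv ℂ (transition f s t) 0), ← h4, smul_smul, Real.exp_sub]
  push_cast
  rw [div_eq_inv_mul]

theorem norm_transition_le (hf : IsNormalizedLoewnerChain f) (hs : 0 ≤ s) (hst : s ≤ t)
    (hz : z ∈ unitBall n) : ‖transition f s t z‖ ≤ ‖z‖ :=
  Complex.norm_le_norm_of_mapsTo_ball (hf.differentiableOn_transition hs hst)
    (fun _ hw => ball_subset_closedBall (hf.transition_mem hs hst hw)) (hf.transition_zero hs hst)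
    (mem_ball_zero_iff.1 hz)

theorem norm_sub_transition_le (hf : IsNormalizedLoewnerChain f) (hs : 0 ≤ s) (hst : s ≤ t)
    {r : ℝ} (hr : r < 1) (hz : ‖z‖ ≤ r) :
    ‖z - transition f s t z‖ ≤ selfMapConst r * (t - s) := by
  have hr0 : 0 ≤ r := (norm_nonneg z).trans hz
  refine (norm_sub_le_of_mapsTo_unitBall (hf.differentiableOn_transition hs hst)
    (fun _ hw => hf.transition_mem hs hst hw) (hf.transition_zero hs hst)
    (hf.fderiv_transition_zero hs hst) (Real.exp_le_one_iff.2 (sub_nonpos.2 hst)) hr hz).trans ?_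
  refine mul_le_mul_of_nonneg_left ?_ (selfMapConst_nonneg hr0)
  linarith [Real.add_one_le_exp (s - t)]

theorem isInvertible_fderiv (hf : IsNormalizedLoewnerChain f) (ht : 0 ≤ t)
    (hz : z ∈ unitBall n) : (fderiv ℂ (f t) z).IsInvertible := by
  have hinj := fderiv_injective_of_injOn n (Cn n) (Cn n) (by simp) (by simp) (f t) (unitBall n)
    isOpen_ball (hf.holomorphic t ht) (hf.injOn t ht) z hz
  exact ⟨(LinearEquiv.ofInjectiveEndo (fderiv ℂ (f t) z : Cn n →ₗ[ℂ] Cn n)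
    hinj).toContinuousLinearEquiv, by ext; rfl⟩

theorem exists_norm_le (hf : IsNormalizedLoewnerChain f) {T r : ℝ} (hT : 0 ≤ T) (hr : r < 1) :
    ∃ M, 0 ≤ M ∧ ∀ t, 0 ≤ t → t ≤ T → ∀ z, ‖z‖ ≤ r → ‖f t z‖ ≤ M := by
  obtain ⟨M, hM⟩ := (isCompact_closedBall (0 : Cn n) r).exists_bound_of_continuousOn
    ((hf.holomorphic T hT).continuousOn.mono (closedBall_subset_ball hr))
  refine ⟨max M 0, le_max_right _ _, fun t ht htT z hz => ?_⟩
  have hzB : z ∈ unitBall n := mem_ball_zero_iff.2 (hz.trans_lt hr)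
  rw [← hf.apply_transition ht htT hzB]
  exact (hM _ (mem_closedBall_zero_iff.2 ((hf.norm_transition_le ht htT hzB).trans hz))).trans
    (le_max_left _ _)

/-- A Loewner chain is Lipschitz in time, uniformly on compact subsets of `[0, ∞) × 𝔹ⁿ`. -/
theorem exists_norm_sub_le (hf : IsNormalizedLoewnerChain f) {T r : ℝ} (hT : 0 ≤ T) (hr0 : 0 ≤ r)
    (hr : r < 1) : ∃ L, 0 ≤ L ∧ ∀ s t, 0 ≤ s → s ≤ T → 0 ≤ t → t ≤ T → ∀ z, ‖z‖ ≤ r →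
      ‖f t z - f s z‖ ≤ L * |t - s| := by
  obtain ⟨R, hrR, hR⟩ := exists_between hr
  obtain ⟨M, hM0, hM⟩ := hf.exists_norm_le hT hR
  have hRr : 0 < R - r := sub_pos.2 hrR
  have key : ∀ s t, 0 ≤ s → s ≤ t → t ≤ T → ∀ z, ‖z‖ ≤ r →
      ‖f t z - f s z‖ ≤ 2 * M / (R - r) * selfMapConst r * (t - s) := by
    intro s t hs hst htT z hz
    have hzB : z ∈ unitBall n := mem_ball_zero_iff.2 (hz.trans_lt hr)
    have ht := hs.trans hst
    rw [← hf.apply_transition hs hst hzB]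
    refine (norm_image_sub_le_of_norm_le_ball hrR ((hf.holomorphic t ht).mono
      (ball_subset_ball hR.le)) (fun w hw => hM t ht htT w (mem_ball_zero_iff.1 hw).le)
      (mem_closedBall_zero_iff.2 ((hf.norm_transition_le hs hst hzB).trans hz))
      (mem_closedBall_zero_iff.2 hz)).trans ?_
    rw [mul_assoc]
    exact mul_le_mul_of_nonneg_left (hf.norm_sub_transition_le hs hst hr hz) (by positivity)
  refine ⟨2 * M / (R - r) * selfMapConst r,
    mul_nonneg (by positivity) (selfMapConst_nonneg hr0), fun s t hs hsT ht htT z hz => ?_⟩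
  rcases le_total s t with h | h
  · rw [abs_of_nonneg (sub_nonneg.2 h)]
    exact key s t hs h htT z hz
  · rw [abs_sub_comm, abs_of_nonneg (sub_nonneg.2 h), norm_sub_rev]
    exact key t s ht h hsT z hz

theorem ae_differentiableAt_apply (hf : IsNormalizedLoewnerChain f) (hz : z ∈ unitBall n) :
    ∀ᵐ t : ℝ ∂volume, 0 < t → DifferentiableAt ℝ (fun τ => f τ z) t := by
  have key : ∀ N : ℕ, ∀ᵐ t : ℝ ∂volume, t ∈ Ioo (0 : ℝ) N →
      DifferentiableAt ℝ (fun τ => f τ z) t := by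
    intro N
    obtain ⟨L, hL0, hL⟩ := hf.exists_norm_sub_le (Nat.cast_nonneg N) (norm_nonneg z)
      (mem_ball_zero_iff.1 hz)
    have hlip : LipschitzOnWith L.toNNReal (fun τ => f τ z) (Icc (0 : ℝ) N) := by
      refine LipschitzOnWith.of_dist_le_mul fun t ht s hs => ?_
      rw [dist_eq_norm, Real.dist_eq, Real.coe_toNNReal _ hL0]
      exact hL s t hs.1 hs.2 ht.1 ht.2 z le_rfl
    filter_upwards [hlip.ae_differentiableWithinAt_of_mem_real] with t ht htN
    exact (ht (Ioo_subset_Icc_self htN)).differentiableAt (Icc_mem_nhds htN.1 htN.2)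
  filter_upwards [ae_all_iff.2 key] with t ht ht0
  obtain ⟨N, hN⟩ := exists_nat_gt t
  exact ht N ⟨ht0, hN⟩

/-- The difference quotients in time are equi-Lipschitz in space by the Cauchy estimate, so their
convergence on a dense set implies convergence everywhere. -/
theorem differentiableAt_of_dense (hf : IsNormalizedLoewnerChain f) (ht : 0 < t) {Q : Set (Cn n)}
    (hQ : Dense Q) (h : ∀ q ∈ Q, q ∈ unitBall n → DifferentiableAt ℝ (fun τ => f τ q) t)
    (hz : z ∈ unitBall n) : DifferentiableAt ℝ (fun τ => f τ z) t := by
  obtain ⟨r, hzr, hr⟩ := exists_between (mem_ball_zero_iff.1 hz)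
  obtain ⟨R, hrR, hR⟩ := exists_between hr
  have hR0 : 0 ≤ R := (norm_nonneg z).trans (hzr.trans hrR).le
  obtain ⟨L, hL0, hL⟩ := hf.exists_norm_sub_le (T := t + 1) (by linarith) hR0 hR
  set C := 2 * L / (R - r) with hC
  have hC0 : 0 ≤ C := by have := sub_pos.2 hrR; positivity
  have hlip : ∀ᶠ τ in 𝓝[≠] t, ∀ w, ‖w‖ ≤ r → ‖slope (fun τ => f τ z) t τ -
      slope (fun τ => f τ w) t τ‖ ≤ C * ‖z - w‖ := by
    filter_upwards [self_mem_nhdsWithin, nhdsWithin_le_nhds (Ioo_mem_nhds ht (lt_add_one t))]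
      with τ hne hτ w hw
    have hne' : 0 < |τ - t| := abs_pos.2 (sub_ne_zero.2 hne)
    have hd : DifferentiableOn ℂ (fun w => slope (fun τ => f τ w) t τ) (ball 0 R) := by
      simp only [slope_def_module]
      have hsub : ball (0 : Cn n) R ⊆ unitBall n := ball_subset_ball hR.le
      exact (((hf.holomorphic τ hτ.1.le).mono hsub).sub
        ((hf.holomorphic t ht.le).mono hsub)).const_smul ((τ - t)⁻¹)
    refine norm_image_sub_le_of_norm_le_ball hrR hd (fun v hv => ?_)
      (mem_closedBall_zero_iff.2 hw) (mem_closedBall_zero_iff.2 hzr.le)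
    rw [slope_def_module, norm_smul, norm_inv, Real.norm_eq_abs, inv_mul_le_iff₀ hne', mul_comm]
    exact hL t τ ht.le (by linarith) hτ.1.le hτ.2.le v (mem_ball_zero_iff.1 hv).le
  have hcauchy : Cauchy (map (slope (fun τ => f τ z) t) (𝓝[≠] t)) := by
    rw [Metric.cauchy_iff]
    refine ⟨inferInstance, fun ε hε => ?_⟩
    obtain ⟨δ, hδ, hδC⟩ : ∃ δ, 0 < δ ∧ C * δ < ε / 4 := by
      refine ⟨ε / 4 / (C + 1), by positivity, ?_⟩
      rw [mul_div_assoc', div_lt_iff₀ (by positivity)]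
      nlinarith
    obtain ⟨q, hqm, hqQ⟩ := hQ.inter_open_nonempty (ball z δ ∩ ball 0 r)
      (isOpen_ball.inter isOpen_ball) ⟨z, mem_ball_self hδ, mem_ball_zero_iff.2 hzr⟩
    have hqr : ‖q‖ < r := mem_ball_zero_iff.1 hqm.2
    have hqd := (h q hqQ (mem_ball_zero_iff.2 (hqr.trans hr))).hasDerivAt
    rw [hasDerivAt_iff_tendsto_slope] at hqd
    refine ⟨ball (deriv (fun τ => f τ q) t) (ε / 2), ?_, fun x hx y hy => ?_⟩
    · rw [mem_map]
      filter_upwards [hlip, hqd.eventually (ball_mem_nhds _ (show 0 < ε / 4 by positivity))]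
        with τ h1 h2
      have h3 := h1 q hqr.le
      have h4 : C * ‖z - q‖ ≤ C * δ := by
        have : ‖z - q‖ < δ := by
          have := mem_ball.1 hqm.1
          rwa [dist_comm, dist_eq_norm] at this
        gcongr
      rw [mem_preimage, mem_ball]
      have h5 := dist_triangle (slope (fun τ => f τ z) t τ) (slope (fun τ => f τ q) t τ)
        (deriv (fun τ => f τ q) t)
      rw [dist_eq_norm (slope (fun τ => f τ z) t τ) (slope (fun τ => f τ q) t τ)] at h5
      linarith
    · linarith [dist_triangle_right x y (deriv (fun τ => f τ q) t), mem_ball.1 hx, mem_ball.1 hy]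
  obtain ⟨v, hv⟩ := cauchy_map_iff_exists_tendsto.1 hcauchy
  exact (hasDerivAt_iff_tendsto_slope.2 hv).differentiableAt

theorem ae_forall_differentiableAt (hf : IsNormalizedLoewnerChain f) :
    ∀ᵐ t : ℝ ∂volume, 0 < t → ∀ z ∈ unitBall n, DifferentiableAt ℝ (fun τ => f τ z) t := by
  obtain ⟨Q, hQc, hQd⟩ := TopologicalSpace.exists_countable_dense (Cn n)
  have h1 : ∀ᵐ t : ℝ ∂volume, ∀ q ∈ Q, q ∈ unitBall n → 0 < t →
      DifferentiableAt ℝ (fun τ => f τ q) t := by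
    rw [ae_ball_iff hQc]
    intro q _
    by_cases hq : q ∈ unitBall n
    · filter_upwards [hf.ae_differentiableAt_apply hq] with t ht _ using ht
    · exact Eventually.of_forall fun t h => absurd h hq
  filter_upwards [h1] with t ht ht0 z hz
  exact hf.differentiableAt_of_dense ht0 hQd (fun q hq hqB => ht q hq hqB ht0) hz

/-- **Loewner's differential equation** in one-sided form: the transition maps start with velocity
minus the Loewner field. It is obtained by expanding `f_τ (φ_{t,τ} z) = f_t z` to first order in
`τ - t`. -/
theorem hasDerivWithinAt_transition (hf : IsNormalizedLoewnerChain f) (ht : 0 ≤ t)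
    (hz : z ∈ unitBall n) (hd : DifferentiableAt ℝ (fun τ => f τ z) t) :
    HasDerivWithinAt (fun τ => transition f t τ z) (-loewnerField f t z) (Ici t) t := by
  obtain ⟨e, he⟩ := hf.isInvertible_fderiv ht hz
  have hz1 : ‖z‖ < 1 := mem_ball_zero_iff.1 hz
  obtain ⟨R, hrR, hR⟩ := exists_between hz1
  set d := R - ‖z‖ with hdef
  have hd0 : 0 < d := sub_pos.2 hrR
  have hR0 : 0 ≤ R := (norm_nonneg z).trans hrR.le
  obtain ⟨M, hM0, hM⟩ := hf.exists_norm_le ht hR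
  obtain ⟨L, hL0, hL⟩ := hf.exists_norm_sub_le (T := t + 1) (by linarith) hR0 hR
  set C := selfMapConst ‖z‖ with hC
  have hC0 : 0 ≤ C := selfMapConst_nonneg (norm_nonneg z)
  have hsubB : ball (0 : Cn n) R ⊆ unitBall n := ball_subset_ball hR.le
  have hsub : ball z d ⊆ ball 0 R := by
    refine ball_subset_ball' ?_
    rw [dist_zero_right, hdef]; linarith
  set err : ℝ → Cn n := fun τ => transition f t τ z - z + e.symm (f τ z - f t z) with herr
  set K := ‖(e.symm : Cn n →L[ℂ] Cn n)‖ * (2 * L / d * C + 4 * M * (C / d) ^ 2) with hK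
  have hsmall : ∀ᶠ τ in 𝓝[≥] t, C * (τ - t) < d := by
    have : Tendsto (fun τ => C * (τ - t)) (𝓝 t) (𝓝 (C * (t - t))) :=
      Continuous.tendsto (by fun_prop) t
    rw [sub_self, mul_zero] at this
    exact nhdsWithin_le_nhds (this.eventually (gt_mem_nhds hd0))
  have hbound : ∀ᶠ τ in 𝓝[≥] t, ‖err τ‖ ≤ K * ‖τ - t‖ ^ 2 := by
    filter_upwards [self_mem_nhdsWithin, hsmall, nhdsWithin_le_nhds (Iio_mem_nhds (lt_add_one t))]
      with τ htτ hτd hτ1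
    have htτ : t ≤ τ := htτ
    have hτ1 : τ < t + 1 := hτ1
    have hτ0 : 0 ≤ τ := ht.trans htτ
    have habs : |τ - t| = τ - t := abs_of_nonneg (sub_nonneg.2 htτ)
    set v := transition f t τ z with hv
    have hvz : ‖v - z‖ ≤ C * (τ - t) := by
      rw [norm_sub_rev]; exact hf.norm_sub_transition_le ht htτ hz1 le_rfl
    have hvn : ‖v‖ ≤ ‖z‖ := hf.norm_transition_le ht htτ hz
    -- The increment of `f τ - f t` between `z` and `v` is of second order.
    have h1 : ‖(f τ v - f t v) - (f τ z - f t z)‖ ≤ 2 * (L * (τ - t)) / d * (C * (τ - t)) := by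
      refine (norm_image_sub_le_of_norm_le_ball (f := fun w => f τ w - f t w) hrR
        (((hf.holomorphic τ hτ0).mono hsubB).sub ((hf.holomorphic t ht).mono hsubB))
        (fun w hw => ?_) (mem_closedBall_zero_iff.2 le_rfl) (mem_closedBall_zero_iff.2 hvn)).trans
        (mul_le_mul_of_nonneg_left hvz ?_)
      · rw [← habs]
        exact hL t τ ht (by linarith) hτ0 hτ1.le w (mem_ball_zero_iff.1 hw).le
      · have := sub_nonneg.2 htτ
        positivity
    have h2 : ‖f t v - f t z - e (v - z)‖ ≤ 4 * M * (C * (τ - t) / d) ^ 2 := by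
      have h3 := norm_sub_sub_fderiv_le_of_norm_le_ball hd0
        ((hf.holomorphic t ht).mono (hsub.trans hsubB))
        (fun w hw => hM t ht le_rfl w (mem_ball_zero_iff.1 (hsub hw)).le) (z := v)
        (by rw [mem_ball, dist_eq_norm]; exact hvz.trans_lt hτd)
      rw [← he] at h3
      refine h3.trans ?_
      gcongr
    have h3 : f τ v = f t z := hf.apply_transition ht htτ hz
    have h4 : err τ = -(e.symm : Cn n →L[ℂ] Cn n) (((f τ v - f t v) - (f τ z - f t z)) +
        (f t v - f t z - e (v - z))) := by
      have : ((f τ v - f t v) - (f τ z - f t z)) + (f t v - f t z - e (v - z))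
          = -(e (v - z) + (f τ z - f t z)) := by rw [h3]; abel
      rw [this, map_neg, neg_neg, map_add]
      simp [herr, hv]
    rw [h4, norm_neg, Real.norm_eq_abs, habs]
    refine (ContinuousLinearMap.le_opNorm _ _).trans ?_
    rw [hK, mul_assoc ‖(e.symm : Cn n →L[ℂ] Cn n)‖]
    refine mul_le_mul_of_nonneg_left ((norm_add_le _ _).trans (add_le_add h1 h2) |>.trans_eq ?_)
      (norm_nonneg _)
    field_simp
  have herr' : HasDerivWithinAt err 0 (Ici t) t := by
    rw [hasDerivWithinAt_iff_isLittleO]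
    have h0 : err t = 0 := by simp [herr, hf.transition_self ht hz]
    simp only [h0, smul_zero, sub_zero]
    refine (Asymptotics.IsBigO.of_bound K (g := fun τ => ‖τ - t‖ ^ 2) ?_).trans_isLittleO
      ((Asymptotics.isLittleO_pow_sub_sub t one_lt_two).mono nhdsWithin_le_nhds)
    filter_upwards [hbound] with τ hτ
    simpa using hτ
  have hlin : HasDerivAt (fun τ => e.symm (f τ z - f t z))
      (e.symm (deriv (fun τ => f τ z) t)) t :=
    ((e.symm : Cn n →L[ℂ] Cn n).restrictScalars ℝ).hasFDerivAt.comp_hasDerivAt t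
      (hd.hasDerivAt.sub_const (f t z))
  have hfield : loewnerField f t z = e.symm (deriv (fun τ => f τ z) t) := by
    rw [loewnerField, ← he, ContinuousLinearMap.inverse_equiv]
    rfl
  have := (herr'.sub hlin.hasDerivWithinAt).add_const z
  rw [zero_sub, ← hfield] at this
  refine this.congr_of_eventuallyEq (Eventually.of_forall fun τ => ?_) ?_ <;> simp [herr]

end IsNormalizedLoewnerChain

end LoewnerBall

/-! ### Squeezing of Loewner chains -/

namespace LoewnerBall

variable {n : ℕ} {f : ℝ → Cn n → Cn n}

theorem re_inner_inv_norm_sq_smul (z w : Cn n) :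
    (inner ℂ ((1 / ‖z‖ ^ 2 : ℝ) • z) w).re = (inner ℂ z w).re / ‖z‖ ^ 2 := by
  rw [RCLike.real_smul_eq_coe_smul (K := ℂ), inner_smul_left, RCLike.conj_ofReal]
  exact (Complex.re_ofReal_mul _ _).trans (one_div_mul_eq_div _ _)

theorem hasDerivWithinAt_nonpos_of_eventually_nonpos {g : ℝ → ℝ} {g' t : ℝ}
    (hg : HasDerivWithinAt g g' (Ici t) t) (h0 : g t = 0) (h : ∀ᶠ τ in 𝓝[>] t, g τ ≤ 0) :
    g' ≤ 0 := by
  have h1 := (hasDerivWithinAt_iff_tendsto_slope' (by simp)).1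
    (hasDerivWithinAt_Ioi_iff_Ici.2 hg)
  refine le_of_tendsto h1 ?_
  filter_upwards [h, self_mem_nhdsWithin] with τ hτ hlt
  rw [slope_def_field, h0, sub_zero]
  exact div_nonpos_of_nonpos_of_nonneg hτ (sub_nonneg.2 (le_of_lt hlt))

namespace IsNormalizedLoewnerChain

/-- The integrated condition and equality at `τ = t` give the inequality between the right
derivatives at `τ = t`. -/
theorem infinitesimalSqueezing_of_integrated (hf : IsNormalizedLoewnerChain f) {T₁ : ℝ}
    {T₂ : EReal} (hT₁ : 0 ≤ T₁) {a : ℝ} (h : IntegratedSqueezing f T₁ T₂ a) :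
    InfinitesimalSqueezing f T₁ T₂ a := by
  have hne : ∀ᵐ t : ℝ ∂volume, t ≠ 0 := compl_mem_ae_iff.2 (measure_singleton 0)
  filter_upwards [hf.ae_forall_differentiableAt, hne] with t hd ht0 htT₁ htT₂ z hz hz0
  have ht : 0 ≤ t := hT₁.trans htT₁
  have hzn : 0 < ‖z‖ := norm_pos_iff.2 hz0
  have hder := hf.hasDerivWithinAt_transition ht hz (hd (ht.lt_of_ne' ht0) z hz)
  obtain ⟨t', htt', ht'T₂⟩ := EReal.lt_iff_exists_real_btwn.1 htT₂
  have htt' : t < t' := EReal.coe_lt_coe_iff.1 htt'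
  set g : ℝ → ℝ := fun τ => (inner ℂ z (transition f t τ z)).re
    - Real.exp (a * (t - τ)) * ‖z‖ ^ 2 with hg
  have hg' : HasDerivWithinAt g (-(inner ℂ z (loewnerField f t z)).re + a * ‖z‖ ^ 2)
      (Ici t) t := by
    have h1 : HasDerivWithinAt (fun τ => (inner ℂ z (transition f t τ z)).re)
        (-(inner ℂ z (loewnerField f t z)).re) (Ici t) t := by
      have := (Complex.reCLM.hasFDerivAt.comp_hasDerivWithinAt t
        (((innerSL ℂ z).restrictScalars ℝ).hasFDerivAt.comp_hasDerivWithinAt t hder))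
      refine this.congr_deriv ?_
      simp
    have h2 : HasDerivAt (fun τ => Real.exp (a * (t - τ)) * ‖z‖ ^ 2)
        (Real.exp (a * (t - t)) * (a * -1) * ‖z‖ ^ 2) t :=
      ((((hasDerivAt_id t).const_sub t).const_mul a).exp).mul_const _
    refine (h1.sub h2.hasDerivWithinAt).congr_deriv ?_
    rw [sub_self, mul_zero, Real.exp_zero]
    ring
  have hgt : g t = 0 := by
    rw [hg]
    simp only [hf.transition_self ht hz, sub_self, mul_zero, Real.exp_zero, one_mul]
    rw [inner_self_eq_norm_sq_to_K]
    simp [← Complex.ofReal_pow]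
  have hle := hasDerivWithinAt_nonpos_of_eventually_nonpos hg' hgt (by
    filter_upwards [Ioo_mem_nhdsGT htt'] with τ hτ
    have hτT : (τ : EReal) < T₂ := (EReal.coe_lt_coe_iff.2 hτ.2).trans ht'T₂
    have h1 : ‖transition f t τ z‖ ≤ Real.exp (a * (t - τ)) * ‖z‖ := h t τ htT₁ hτ.1 hτT z hz
    have h2 := (Complex.re_le_norm _).trans (norm_inner_le_norm (𝕜 := ℂ) z (transition f t τ z))
    have h3 := mul_le_mul_of_nonneg_left h1 hzn.le
    simp only [hg]
    nlinarith)
  rw [re_inner_inv_norm_sq_smul, le_div_iff₀ (by positivity)]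
  linarith

/-- The function `τ ↦ e^{2aτ} ‖φ_{s,τ} z‖²` is absolutely continuous, and by the Loewner equation
its derivative is nonpositive almost everywhere. -/
theorem integratedSqueezing_of_infinitesimal (hf : IsNormalizedLoewnerChain f) {T₁ : ℝ}
    {T₂ : EReal} (hT₁ : 0 ≤ T₁) {a : ℝ} (ha : 0 < a) (h : InfinitesimalSqueezing f T₁ T₂ a) :
    IntegratedSqueezing f T₁ T₂ a := by
  intro s t hs hst htT₂ z hz
  have hs0 : 0 ≤ s := hT₁.trans hs
  rcases eq_or_ne z 0 with rfl | hz0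
  · have : transition f s t 0 = 0 := hf.transition_zero hs0 hst.le
    rw [transition] at this
    simp [this]
  have hz1 : ‖z‖ < 1 := mem_ball_zero_iff.1 hz
  set v : ℝ → Cn n := fun τ => transition f s τ z with hv
  have hvB : ∀ τ, s ≤ τ → v τ ∈ unitBall n := fun τ hτ => hf.transition_mem hs0 hτ hz
  have hvn : ∀ τ, s ≤ τ → ‖v τ‖ ≤ ‖z‖ := fun τ hτ => hf.norm_transition_le hs0 hτ hz
  have hv0 : ∀ τ, s ≤ τ → v τ ≠ 0 := by
    intro τ hτ h0
    have h1 := hf.apply_transition hs0 hτ hz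
    change f τ (v τ) = f s z at h1
    rw [h0, hf.map_zero τ (hs0.trans hτ), ← hf.map_zero s hs0] at h1
    exact hz0 (hf.injOn s hs0 hz (mem_ball_self one_pos) h1.symm)
  have hC0 := selfMapConst_nonneg (norm_nonneg z)
  have hlip : LipschitzOnWith (selfMapConst ‖z‖).toNNReal (fun τ => ‖v τ‖) (uIcc s t) := by
    rw [uIcc_of_le hst.le]
    have key : ∀ τ σ, s ≤ τ → τ ≤ σ → ‖v τ - v σ‖ ≤ selfMapConst ‖z‖ * (σ - τ) := by
      intro τ σ hτ hτσ
      have : v σ = transition f τ σ (v τ) := hf.transition_trans hs0 hτ hτσ hz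
      rw [this]
      exact hf.norm_sub_transition_le (hs0.trans hτ) hτσ hz1 (hvn τ hτ)
    refine LipschitzOnWith.of_dist_le_mul fun τ hτ σ hσ => ?_
    rw [Real.coe_toNNReal _ hC0, Real.dist_eq, Real.dist_eq]
    refine (abs_norm_sub_norm_le _ _).trans ?_
    rcases le_total τ σ with hle | hle
    · rw [abs_sub_comm, abs_of_nonneg (sub_nonneg.2 hle)]
      exact key τ σ hτ.1 hle
    · rw [abs_of_nonneg (sub_nonneg.2 hle), norm_sub_rev]
      exact key σ τ hσ.1 hle
  set y : ℝ → ℝ := fun τ => Real.exp (2 * a * τ) * (‖v τ‖ * ‖v τ‖) with hy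
  have hexp : AbsolutelyContinuousOnInterval (fun τ => Real.exp (2 * a * τ)) s t :=
    ContDiffOn.absolutelyContinuousOnInterval (by fun_prop)
  have hnorm := hlip.absolutelyContinuousOnInterval
  have hyac : AbsolutelyContinuousOnInterval y s t := hexp.mul (hnorm.mul hnorm)
  have hyd : ∀ᵐ τ ∂volume, τ ∈ Ioo s t → deriv y τ ≤ 0 := by
    filter_upwards [h] with τ hτ hτst
    by_cases hdiff : DifferentiableAt ℝ y τ
    swap
    · rw [deriv_zero_of_not_differentiableAt hdiff]
    have hτ0 : 0 ≤ τ := hs0.trans hτst.1.le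
    have hre := hτ (hs.trans hτst.1.le) ((EReal.coe_lt_coe_iff.2 hτst.2).trans htT₂) (v τ)
      (hvB τ hτst.1.le) (hv0 τ hτst.1.le)
    have hd := (differentiableAt_and_isInvertible_of_le ha hre).1
    have hvn0 : 0 < ‖v τ‖ := norm_pos_iff.2 (hv0 τ hτst.1.le)
    rw [re_inner_inv_norm_sq_smul, le_div_iff₀ (by positivity)] at hre
    have hv' : HasDerivWithinAt v (-loewnerField f τ (v τ)) (Ici τ) τ := by
      refine (hf.hasDerivWithinAt_transition hτ0 (hvB τ hτst.1.le) hd).congr (fun σ hσ => ?_) ?_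
      · exact hf.transition_trans hs0 hτst.1.le hσ hz
      · exact hf.transition_trans hs0 hτst.1.le le_rfl hz
    have hn' := hv'.norm_sq
    have he' : HasDerivAt (fun τ => Real.exp (2 * a * τ)) (Real.exp (2 * a * τ) * (2 * a * 1)) τ :=
      ((hasDerivAt_id τ).const_mul (2 * a)).exp
    have hy' := (he'.hasDerivWithinAt (s := Ici τ)).mul hn'
    have hyy : ((fun τ => Real.exp (2 * a * τ)) * fun τ => ‖v τ‖ ^ 2) = y := by
      funext σ; simp only [hy, sq, Pi.mul_apply]
    have huniq := (uniqueDiffWithinAt_Ici τ).eq_deriv _ hdiff.hasDerivAt.hasDerivWithinAt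
      (hyy ▸ hy')
    have hinner : inner ℝ (v τ) (-loewnerField f τ (v τ))
        = -(inner ℂ (v τ) (loewnerField f τ (v τ))).re := by
      rw [inner_neg_right, PiLp.inner_apply, PiLp.inner_apply, Complex.re_sum]
      rfl
    rw [huniq, hinner]
    have hE := Real.exp_pos (2 * a * τ)
    nlinarith
  have hle : y t ≤ y s := by
    have h1 := hyac.integral_deriv_eq_sub
    have h2 : 0 ≤ ∫ τ in s..t, -deriv y τ := by
      refine intervalIntegral.integral_nonneg_of_ae_restrict hst.le ?_
      rw [← restrict_Ioo_eq_restrict_Icc, Filter.EventuallyLE, ae_restrict_iff' measurableSet_Ioo]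
      filter_upwards [hyd] with τ hτ hm
      simpa using hτ hm
    rw [intervalIntegral.integral_neg, h1] at h2
    linarith
  have hvs : v s = z := hf.transition_self hs0 hz
  have hsq : ∀ τ, y τ = (Real.exp (a * τ) * ‖v τ‖) ^ 2 := by
    intro τ
    simp only [hy, mul_pow, ← Real.exp_nat_mul, sq ‖v τ‖]
    congr 2
    push_cast; ring
  rw [hsq, hsq, hvs] at hle
  have hfin := le_of_sq_le_sq hle (by positivity)
  change ‖v t‖ ≤ _
  rw [mul_sub, Real.exp_sub, div_mul_eq_mul_div, le_div_iff₀ (Real.exp_pos _), mul_comm]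
  exact hfin

/-- The image of `f s` is contained in the image under `f t` of a closed ball of radius less than
one. -/
theorem exists_image_subset_image_closedBall (hf : IsNormalizedLoewnerChain f) {T₁ : ℝ}
    {T₂ : EReal} (hT₁ : 0 ≤ T₁) {a : ℝ} (ha : 0 < a) (h : IntegratedSqueezing f T₁ T₂ a) {s t : ℝ}
    (hs : T₁ ≤ s) (hst : s < t) (ht : (t : EReal) < T₂) :
    ∃ r < 1, f s '' unitBall n ⊆ f t '' closedBall 0 r := by
  refine ⟨Real.exp (a * (s - t)), ?_, ?_⟩
  · rw [Real.exp_lt_one_iff]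
    exact mul_neg_of_pos_of_neg ha (sub_neg.2 hst)
  · rintro _ ⟨z, hz, rfl⟩
    refine ⟨transition f s t z, mem_closedBall_zero_iff.2 ?_,
      hf.apply_transition (hT₁.trans hs) hst.le hz⟩
    exact (h s t hs hst ht z hz).trans (mul_le_of_le_one_right (Real.exp_pos _).le
      (mem_ball_zero_iff.1 hz).le)

theorem isCompact_image_closedBall (hf : IsNormalizedLoewnerChain f) {t r : ℝ} (ht : 0 ≤ t)
    (hr : r < 1) : IsCompact (f t '' closedBall 0 r) :=
  (isCompact_closedBall 0 r).image_of_continuousOn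
    ((hf.holomorphic t ht).continuousOn.mono (closedBall_subset_ball hr))

end IsNormalizedLoewnerChain

end LoewnerBall

theorem proposition2p3 {n : ℕ}
    (f : ℝ → LoewnerBall.Cn n → LoewnerBall.Cn n)
    (hf : LoewnerBall.IsNormalizedLoewnerChain f)
    (T₁ : ℝ) (T₂ : EReal) (hT₁ : 0 ≤ T₁) (hT : (T₁ : EReal) < T₂)
    (a : ℝ) (ha : a ∈ Set.Ioc (0 : ℝ) 1) :
    (LoewnerBall.InfinitesimalSqueezing f T₁ T₂ a ↔ LoewnerBall.IntegratedSqueezing f T₁ T₂ a) ∧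
    (LoewnerBall.InfinitesimalSqueezing f T₁ T₂ a ∨ LoewnerBall.IntegratedSqueezing f T₁ T₂ a →
      (∀ t : ℝ, 0 ≤ t → (t : EReal) < T₂ →
        Bornology.IsBounded (f t '' LoewnerBall.unitBall n)) ∧
      (∀ s t : ℝ, T₁ ≤ s → s < t → (t : EReal) < T₂ →
        closure (f s '' LoewnerBall.unitBall n) ⊆ f t '' LoewnerBall.unitBall n)) := by
  have hiff : LoewnerBall.InfinitesimalSqueezing f T₁ T₂ a ↔
      LoewnerBall.IntegratedSqueezing f T₁ T₂ a :=
    ⟨hf.integratedSqueezing_of_infinitesimal hT₁ ha.1, hf.infinitesimalSqueezing_of_integrated hT₁⟩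
  refine ⟨hiff, fun h => ?_⟩
  have h : LoewnerBall.IntegratedSqueezing f T₁ T₂ a := h.elim hiff.1 id
  refine ⟨fun t ht htT₂ => ?_, fun s t hs hst ht => ?_⟩
  · -- Pass to a time `u ≥ t` in `[T₁, T₂)` and to a later one `u'`.
    have hu : ((max t T₁ : ℝ) : EReal) < T₂ := by
      rcases max_choice t T₁ with h1 | h1 <;> rw [h1] <;> assumption
    obtain ⟨u', huu', hu'T₂⟩ := EReal.lt_iff_exists_real_btwn.1 hu
    have huu' : max t T₁ < u' := EReal.coe_lt_coe_iff.1 huu'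
    obtain ⟨r, hr, hsub⟩ := hf.exists_image_subset_image_closedBall hT₁ ha.1 h
      (le_max_right t T₁) huu' hu'T₂
    refine (hf.isCompact_image_closedBall ((ht.trans (le_max_left t T₁)).trans huu'.le)
      hr).isBounded.subset (Set.Subset.trans ?_ hsub)
    rintro _ ⟨z, hz, rfl⟩
    exact ⟨_, hf.transition_mem ht (le_max_left t T₁) hz,
      hf.apply_transition ht (le_max_left t T₁) hz⟩
  · obtain ⟨r, hr, hsub⟩ := hf.exists_image_subset_image_closedBall hT₁ ha.1 h hs hst ht
    refine (closure_minimal hsub (hf.isCompact_image_closedBall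
      ((hT₁.trans hs).trans hst.le) hr).isClosed).trans ?_
    exact Set.image_mono (Metric.closedBall_subset_ball hr)
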